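/- Let $S$ be a Hausdorff space with its Borel $\sigma$-field, let $X_1,X_2,\dots$ be i.i.d. $S$-valued random variables with law $\mathbf P$, and let $\widehat{\mathbf P}_n$ be the empirical measure of $X_1,\dots,X_n$. Given $\widehat{\mathbf P}_n$, let $X_1^*,\dots,X_{k_n}^*$ be i.i.d. with law $\widehat{\mathbf P}_n$ and let $\mathbf P^*_{k_n}$ be their empirical measure, where $k_n\to\infty$ and $k_n/n<c_0$ for all $n\ge 1$ and some constant $c_0<\infty$. For a set $\Theta$ of measurable functions $f:S\to\mathbb R$ let $\Lambda_{0\Theta}$ be the set of finite signed measures $\mathbf G$ on $S$ with $\mathbf G(S)=0$ and $\int|f|\,d|\mathbf G|<\infty$ for all $f\in\Theta$. Let $\tau_\Theta$ and $\sigma_\Theta$ be the coarsest topology and the smallest $\sigma$-algebra on $\Lambda_{0\Theta}$ for which all maps $\mathbf G\mapsto\int f\,d\mathbf G$, $f\in\Theta$, are continuous, respectively measurable. Put $\rho_0^2(\mathbf G,\mathbf P)=\frac12\int\left(\frac{d\mathbf G}{d\mathbf P}\right)^2d\mathbf P$ if $\mathbf G\ll\mathbf P$ and $\rho_0^2(\mathbf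 G,\mathbf P)=\infty$ otherwise, and $\rho_0^2(\Omega,\mathbf P)=\inf_{\mathbf G\in\Omega}\rho_0^2(\mathbf G,\mathbf P)$, with $\inf\emptyset=\infty$. For $\Omega_0\subset\Lambda_{0\Theta}$ and $a>0$, the conditional outer probability $(\widehat{\mathbf P}_n)^*(\mathbf P^*_{k_n}\in\widehat{\mathbf P}_n+a\Omega_0)$ is the infimum, over all $A\in\sigma_\Theta$ with $\Omega_0\subset A$, of the conditional probability of $\{\mathbf P^*_{k_n}\in\widehat{\mathbf P}_n+aA\}$ given $\widehat{\mathbf P}_n$; the inner probability is $(\widehat{\mathbf P}_n)_*(\mathbf P^*_{k_n}\in\widehat{\mathbf P}_n+a\Omega_0)=1-(\widehat{\mathbf P}_n)^*(\mathbf P^*_{k_n}\in\widehat{\mathbf P}_n+a(\Lambda_{0\Theta}\setminus\Omega_0))$. For extended real, not necessarily measurable $Z_n$, "$\liminf Z_n\ge c$ a.s.$_*$" means that there are measurable $\Delta_n\le Z_n$ with $\liminf\Delta_n\ge c$ almost surely, and "$\limsup Z_n\le c$ a.s.$^*$" means that $\liminf(-Z_n)\ge -c$ a.s.$_*$. Let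 $\Theta_0$ be the set of bounded measurable functions, and for $t>2$ let $\Theta_t$ be the set of measurable $f$ with $E|f(X_1)|^t<\infty$. For $h:(0,\infty)\to[0,\infty)$ let $\Theta_{2,h}$ be the set of measurable $f$ with $E|f(X_1)|^2<\infty$ and $\mathbf P(|f(X_1)|>s^{-1})<h(s)$ for all $s>0$. **Theorem.** Let $a_n>0$ be a nonincreasing sequence with $a_n\to0$, $a_{n+1}/a_n\to1$ and $k_na_n^2\to\infty$. Consider, for $\Omega_0\subset\Lambda_{0\Theta}$, the relations $$\liminf_{n\to\infty}(k_na_n^2)^{-1}\ln(\widehat{\mathbf P}_n)_*(\mathbf P^*_{k_n}\in\widehat{\mathbf P}_n+a_n\Omega_0)\ge-\rho_0^2(\mathrm{int}(\Omega_0),\mathbf P)\quad\text{a.s.}_*,\qquad(1)$$ $$\limsup_{n\to\infty}(k_na_n^2)^{-1}\ln(\widehat{\mathbf P}_n)^*(\mathbf P^*_{k_n}\in\widehat{\mathbf P}_n+a_n\Omega_0)\le-\rho_0^2(\mathrm{cl}(\Omega_0),\mathbf P)\quad\text{a.s.}^*,\qquad(2)$$ with $\ln 0=-\infty$ and with interior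 and closure in $\tau_\Theta$. (i) If $\sum_{n=1}^\infty h(ca_n)<\infty$ for every $c>0$, then (1) and (2) hold for every $\Omega_0\subset\Lambda_{0\Theta}$, both for $\Theta=\Theta_{2,h}$ and for $\Theta=\Theta_{2,h}\cup\Theta_0$. (ii) If $t>2$ and $a_n=o(n^{-1/t})$, then (1) and (2) hold for every $\Omega_0\subset\Lambda_{0\Theta}$ with $\Theta=\Theta_t$. -/

import Mathlib

open MeasureTheory ProbabilityTheory Filter Topology
open scoped ENNReal NNReal

noncomputable section

namespace BootstrapMDP

variable {S : Type*} [MeasurableSpace S]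

/-- The class `Θ₀` of all bounded measurable functions on `S`. -/
def boundedClass (S : Type*) [MeasurableSpace S] : Set (S → ℝ) :=
  {f | Measurable f ∧ ∃ C : ℝ, ∀ x, |f x| ≤ C}

/-- The class `Θ_t` of measurable functions with `E |f(X)|^t < ∞`, where `X` has law `P`. -/
def momentClass (P : Measure S) (t : ℝ) : Set (S → ℝ) :=
  {f | Measurable f ∧ Integrable (fun x => |f x| ^ t) P}

/-- The class `Θ_{t,h}` of functions in `Θ_t` with `P(|f(X)| > s⁻¹) < h(s)` for all `s > 0`. -/
def tailClass (P : Measure S) (t : ℝ) (h : ℝ → ℝ) : Set (S → ℝ) :=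
  {f | f ∈ momentClass P t ∧ ∀ s : ℝ, 0 < s → P.real {x | s⁻¹ < |f x|} < h s}

/-- The space `Λ_{0Θ}` of finite signed measures `G` on `S` with `G(S) = 0` and
`∫ |f| d|G| < ∞` for every `f ∈ Θ`. -/
structure ZeroMassMeasure (Θ : Set (S → ℝ)) where
  /-- the underlying signed measure -/
  val : SignedMeasure S
  mass_eq_zero : val Set.univ = 0
  integrable : ∀ f ∈ Θ, Integrable f val.variation

/-- The family of evaluations `G ↦ ∫ f dG`, `f ∈ Θ`. -/
def evalMap (Θ : Set (S → ℝ)) (G : ZeroMassMeasure Θ) (f : Θ) : ℝ :=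
  G.val.integral (f : S → ℝ) (ContinuousLinearMap.lsmul ℝ ℝ)

/-- The `τ_Θ`-topology: the coarsest one that makes every `G ↦ ∫ f dG`, `f ∈ Θ`, continuous. -/
instance instTopologicalSpaceZeroMassMeasure (Θ : Set (S → ℝ)) :
    TopologicalSpace (ZeroMassMeasure Θ) :=
  TopologicalSpace.induced (evalMap Θ) inferInstance

/-- The `σ_Θ`-algebra: the smallest one that makes every `G ↦ ∫ f dG`, `f ∈ Θ`, measurable. -/
instance instMeasurableSpaceZeroMassMeasure (Θ : Set (S → ℝ)) :
    MeasurableSpace (ZeroMassMeasure Θ) :=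
  MeasurableSpace.comap (evalMap Θ) inferInstance

open scoped Classical in
/-- The rate function `ρ₀²(G, P) = (1/2) ∫ (dG/dP)² dP` if `G ≪ P`, and `∞` otherwise. -/
def rate (P : Measure S) (G : SignedMeasure S) : ℝ≥0∞ :=
  if G.variation ≪ P then 2⁻¹ * ∫⁻ x, ENNReal.ofReal (G.rnDeriv P x ^ 2) ∂P else ∞

/-- `ρ₀²(Ω₀, P) = inf {ρ₀²(G, P) : G ∈ Ω₀}`, which is `∞` for the empty set. -/
def rateSet (P : Measure S) {Θ : Set (S → ℝ)} (Ω₀ : Set (ZeroMassMeasure Θ)) : ℝ≥0∞ :=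
  ⨅ G ∈ Ω₀, rate P G.val

/-- The empirical measure of the points `x 0, …, x (n - 1)`. -/
def empirical {n : ℕ} (x : Fin n → S) : Measure S :=
  (n : ℝ≥0)⁻¹ • ∑ i, Measure.dirac (x i)

instance instIsFiniteMeasureEmpirical {n : ℕ} (x : Fin n → S) :
    IsFiniteMeasure (empirical x) := by
  unfold empirical
  infer_instance

/-- Given the sample `x` with empirical measure `P̂`, the event `P* ∈ P̂ + a A` for the empirical
measure `P*` of a bootstrap sample `y = (y₁, …, y_k)`. -/
def bootstrapEvent {Θ : Set (S → ℝ)} {n : ℕ} (x : Fin n → S) (k : ℕ) (a : ℝ)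
    (A : Set (ZeroMassMeasure Θ)) : Set (Fin k → S) :=
  {y | ∃ G ∈ A,
    (empirical y).toSignedMeasure = (empirical x).toSignedMeasure + a • G.val}

/-- The outer probability, with respect to `σ_Θ`, of `P* ∈ P̂ + a Ω₀` given the sample `x`: the
bootstrap sample consists of `k` independent variables with law `P̂ = empirical x`. -/
def bootstrapOuter {Θ : Set (S → ℝ)} {n : ℕ} (x : Fin n → S) (k : ℕ) (a : ℝ)
    (Ω₀ : Set (ZeroMassMeasure Θ)) : ℝ≥0∞ :=
  ⨅ (A : Set (ZeroMassMeasure Θ)) (_ : Ω₀ ⊆ A) (_ : MeasurableSet A),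
    Measure.pi (fun _ : Fin k => empirical x) (bootstrapEvent x k a A)

/-- The inner probability: one minus the outer probability of the complement in `Λ_{0Θ}`. -/
def bootstrapInner {Θ : Set (S → ℝ)} {n : ℕ} (x : Fin n → S) (k : ℕ) (a : ℝ)
    (Ω₀ : Set (ZeroMassMeasure Θ)) : ℝ≥0∞ :=
  1 - bootstrapOuter x k a Ω₀ᶜ

/-- `liminf Z_n ≥ c` inner almost surely, for `Z_n` that need not be measurable. -/
def LiminfGeInnerAS {Υ : Type*} [MeasurableSpace Υ] (μ : Measure Υ) (Z : ℕ → Υ → EReal)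
    (c : EReal) : Prop :=
  ∃ Δ : ℕ → Υ → EReal, (∀ n, Measurable (Δ n)) ∧ (∀ n ω, Δ n ω ≤ Z n ω) ∧
    ∀ᵐ ω ∂μ, c ≤ liminf (fun n => Δ n ω) atTop

/-- `limsup Z_n ≤ c` outer almost surely, i.e. `liminf (-Z_n) ≥ -c` inner almost surely. -/
def LimsupLeOuterAS {Υ : Type*} [MeasurableSpace Υ] (μ : Measure Υ) (Z : ℕ → Υ → EReal)
    (c : EReal) : Prop :=
  LiminfGeInnerAS μ (fun n ω => -Z n ω) (-c)

/-- The first `n` observations. -/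
def sample {Υ : Type*} (X : ℕ → Υ → S) (n : ℕ) (ω : Υ) : Fin n → S := fun i => X i ω

/-- The almost sure conditional moderate deviation principle in the `τ_Θ`-topology for the
bootstrap empirical measures of sizes `k n`, at speed `k n * (a n)²`. The logarithm takes values
in `[-∞, ∞]`, with `log 0 = -∞`. -/
def ConditionalMDP {Υ : Type*} [MeasurableSpace Υ] (μ : Measure Υ) (X : ℕ → Υ → S)
    (P : Measure S) (k : ℕ → ℕ) (a : ℕ → ℝ) (Θ : Set (S → ℝ)) : Prop :=
  ∀ Ω₀ : Set (ZeroMassMeasure Θ),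
    LiminfGeInnerAS μ
      (fun n ω => (((k n * a n ^ 2)⁻¹ : ℝ) : EReal) *
        ENNReal.log (bootstrapInner (sample X n ω) (k n) (a n) Ω₀))
      (-(rateSet P (interior Ω₀) : EReal)) ∧
    LimsupLeOuterAS μ
      (fun n ω => (((k n * a n ^ 2)⁻¹ : ℝ) : EReal) *
        ENNReal.log (bootstrapOuter (sample X n ω) (k n) (a n) Ω₀))
      (-(rateSet P (closure Ω₀) : EReal))

end BootstrapMDP

end

noncomputable section

namespace BootstrapMDP

variable {S : Type*} [MeasurableSpace S]

set_option linter.unusedSectionVars false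

/-! Everything rests on one limit. Call `f` admissible if it is square integrable and `a n *
max_{i<n} |f (X i)| → 0` almost surely. A second-order Taylor expansion of the exponential and the
strong law then give `logMgf → Var[f; P] / 2` almost surely (`tendsto_logMgf`). Bootstrap variables
are conditionally independent, so `logMgf` is exactly the scaled cumulant function of the deviation
`(P* f - P̂ f) / a`. Both bounds become deterministic statements about samples for which finitely
many `logMgf` values are near their limits; `liminfGeInnerAS_of_logMgf` does this reduction and
handles measurability.

Lower bound: a basic neighbourhood of a measure with density `g` is a box in finitely many
coordinates `∫ f_i dG`. Projecting `g` onto the span of the centred `f_i` gives a tilt `u = ∑ l_i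
f_i` with the right covariances and variance at most `∫ g²`. No change of measure is made:
`exp_logMgf_le_prob_add` splits the exponential moment of `u` into the part inside the box and the
parts outside, which slightly perturbed tilts show to be negligible.

Upper bound: the densities of rate at most `c` have a compact image in `Θ → ℝ`
(`isCompact_setOf_pairing`), disjoint from the closure of `Ω₀` when `c` is below the infimum of the
rate. A uniform gap between the two sets involves finitely many coordinates. There Hahn-Banach and
compactness cover the far points by finitely many half-spaces (`exists_finset_halfSpaces`), and each
half-space gets a Chernoff bound.

The function classes of the theorem are admissible by Borel-Cantelli. -/

theorem ZeroMassMeasure.ext {Θ : Set (S → ℝ)} {G H : ZeroMassMeasure Θ} (h : G.val = H.val) :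
    G = H := by
  cases G; cases H; cases h; rfl

/-! ### Signed measures with densities and their rate -/

theorem lsmul_flip_real :
    (ContinuousLinearMap.lsmul ℝ ℝ : ℝ →L[ℝ] ℝ →L[ℝ] ℝ).flip = ContinuousLinearMap.lsmul ℝ ℝ := by
  ext; simp

theorem integral_toSignedMeasure_lsmul (m : Measure S) [IsFiniteMeasure m] (f : S → ℝ) :
    m.toSignedMeasure.integral f (ContinuousLinearMap.lsmul ℝ ℝ) = ∫ x, f x ∂m := by
  rw [← VectorMeasure.integral_toSignedMeasure (μ := m) (f := f), lsmul_flip_real]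

/-- Splitting `g` into positive and negative parts reduces the vector-measure integral to two
integrals against finite positive measures. -/
theorem integral_withDensityᵥ_lsmul {P : Measure S} {f g : S → ℝ}
    (hf : Measurable f) (hg : Measurable g) (hgi : Integrable g P)
    (hfg : Integrable (fun x => f x * g x) P) :
    (P.withDensityᵥ g).integral f (ContinuousLinearMap.lsmul ℝ ℝ) = ∫ x, f x * g x ∂P := by
  have h1 : Integrable (fun x => (ENNReal.ofReal (g x)).toReal * f x) P := by
    refine hfg.mono (by fun_prop) (ae_of_all _ fun x => ?_)
    simp only [norm_mul, Real.norm_eq_abs, ENNReal.toReal_ofReal', mul_comm |f x|]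
    refine mul_le_mul_of_nonneg_right ?_ (abs_nonneg _)
    rw [abs_of_nonneg (le_max_right (_ : ℝ) 0)]
    exact max_le (le_abs_self _) (abs_nonneg _)
  have h2 : Integrable (fun x => (ENNReal.ofReal (-g x)).toReal * f x) P := by
    refine hfg.mono (by fun_prop) (ae_of_all _ fun x => ?_)
    simp only [norm_mul, Real.norm_eq_abs, ENNReal.toReal_ofReal', mul_comm |f x|]
    refine mul_le_mul_of_nonneg_right ?_ (abs_nonneg _)
    rw [abs_of_nonneg (le_max_right (_ : ℝ) 0)]
    exact max_le (neg_le_abs _) (abs_nonneg _)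
  have hpos := isFiniteMeasure_withDensity_ofReal hgi.2
  have hneg := isFiniteMeasure_withDensity_ofReal hgi.neg.2
  simp only [Pi.neg_apply] at hneg
  have e1 := integrable_withDensity_iff_integrable_smul' (μ := P) (g := f)
    (f := fun x => ENNReal.ofReal (g x)) (by fun_prop) (by simp)
  have e2 := integrable_withDensity_iff_integrable_smul' (μ := P) (g := f)
    (f := fun x => ENNReal.ofReal (-g x)) (by fun_prop) (by simp)
  have k1 := e1.2 (by simpa using h1)
  have k2 := e2.2 (by simpa using h2)
  rw [withDensityᵥ_eq_withDensity_pos_part_sub_withDensity_neg_part hgi,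
    VectorMeasure.integral_sub_vectorMeasure, integral_toSignedMeasure_lsmul,
    integral_toSignedMeasure_lsmul, integral_withDensity_eq_integral_toReal_smul (by fun_prop)
    (by simp), integral_withDensity_eq_integral_toReal_smul (by fun_prop) (by simp),
    ← integral_sub (by simpa using h1) (by simpa using h2)]
  · refine integral_congr_ae (ae_of_all _ fun x => ?_)
    simp only [smul_eq_mul, ENNReal.toReal_ofReal']
    rcases le_total 0 (g x) with h | h
    · rw [max_eq_left h, max_eq_right (by linarith)]; ring
    · rw [max_eq_right h, max_eq_left (by linarith)]; ring
  · simpa [VectorMeasure.Integrable] using k1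
  · simpa [VectorMeasure.Integrable] using k2

theorem lintegral_ofReal_sq {P : Measure S} {g : S → ℝ} (hg : MemLp g 2 P) :
    ∫⁻ x, ENNReal.ofReal (g x ^ 2) ∂P = ENNReal.ofReal (∫ x, g x ^ 2 ∂P) :=
  (ofReal_integral_eq_lintegral_ofReal hg.integrable_sq (ae_of_all _ fun _ => sq_nonneg _)).symm

theorem two_inv_mul_ofReal (r : ℝ) :
    (2⁻¹ : ℝ≥0∞) * ENNReal.ofReal r = ENNReal.ofReal (r / 2) := by
  rw [div_eq_inv_mul, ENNReal.ofReal_mul (by norm_num),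
    ENNReal.ofReal_inv_of_pos (by norm_num), ENNReal.ofReal_ofNat]

/-- With `exists_density_of_rate_ne_top` this identifies measures of finite rate with mean-zero `L²`
densities. Square integrability of `Θ` makes every `f * g` integrable, so the measure with density
`g` does lie in `Λ_{0Θ}`. -/
theorem exists_zeroMassMeasure_of_density {P : Measure S} [IsProbabilityMeasure P]
    {Θ : Set (S → ℝ)} (hΘm : ∀ f ∈ Θ, Measurable f) (hΘ : ∀ f ∈ Θ, MemLp f 2 P)
    {g : S → ℝ} (hgm : Measurable g) (hg : MemLp g 2 P) (hg0 : ∫ x, g x ∂P = 0) :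
    ∃ G : ZeroMassMeasure Θ, (∀ f : Θ, evalMap Θ G f = ∫ x, (f : S → ℝ) x * g x ∂P) ∧
      rate P G.val = ENNReal.ofReal ((∫ x, g x ^ 2 ∂P) / 2) := by
  have hgi : Integrable g P := hg.integrable (by norm_num)
  have hfg : ∀ f ∈ Θ, Integrable (fun x => f x * g x) P := fun f hf => (hΘ f hf).integrable_mul hg
  refine ⟨⟨P.withDensityᵥ g, ?_, ?_⟩, ?_, ?_⟩
  · rw [withDensityᵥ_apply hgi MeasurableSet.univ, setIntegral_univ, hg0]
  · intro f hf
    rw [Measure.variation_withDensityᵥ hgi,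
      integrable_withDensity_iff_integrable_smul' (by fun_prop) (by simp)]
    refine ((hfg f hf).mono (by have := hΘm f hf; fun_prop) (ae_of_all _ fun x => ?_))
    simp [mul_comm]
  · intro f
    exact integral_withDensityᵥ_lsmul (hΘm f f.2) hgm hgi (hfg f f.2)
  · have hac : (P.withDensityᵥ g).variation ≪ P := by
      rw [Measure.variation_withDensityᵥ hgi]
      exact withDensity_absolutelyContinuous _ _
    -- Uniqueness of the Lebesgue decomposition, with zero singular part.
    have hrn : g =ᵐ[P] SignedMeasure.rnDeriv (P.withDensityᵥ g) P :=
      SignedMeasure.eq_rnDeriv 0 g hgi VectorMeasure.MutuallySingular.zero_left (by simp)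
    rw [rate, if_pos hac, lintegral_congr_ae (g := fun x => ENNReal.ofReal (g x ^ 2)),
      lintegral_ofReal_sq hg, two_inv_mul_ofReal]
    filter_upwards [hrn] with x hx
    rw [hx]

theorem exists_density_of_rate_ne_top {P : Measure S} [IsProbabilityMeasure P]
    {Θ : Set (S → ℝ)} (hΘm : ∀ f ∈ Θ, Measurable f) (hΘ : ∀ f ∈ Θ, MemLp f 2 P)
    {G : ZeroMassMeasure Θ} (hG : rate P G.val ≠ ∞) :
    ∃ g : S → ℝ, Measurable g ∧ MemLp g 2 P ∧ ∫ x, g x ∂P = 0 ∧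
      (∀ f : Θ, evalMap Θ G f = ∫ x, (f : S → ℝ) x * g x ∂P) ∧
      rate P G.val = ENNReal.ofReal ((∫ x, g x ^ 2 ∂P) / 2) := by
  have hac : G.val.variation ≪ P := by
    by_contra h
    exact hG (by rw [rate, if_neg h])
  have hac' : G.val ≪ᵥ P.toENNRealVectorMeasure := by
    refine VectorMeasure.AbsolutelyContinuous.mk fun s hs h => ?_
    rw [Measure.toENNRealVectorMeasure_apply_measurable hs] at h
    have := VectorMeasure.enorm_measure_le_variation G.val s
    rw [hac h] at this
    simpa using this
  have hd := SignedMeasure.withDensityᵥ_rnDeriv_eq G.val P hac'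
  set g := G.val.rnDeriv P with hgdef
  have hgm : Measurable g := SignedMeasure.measurable_rnDeriv _ _
  have hgi : Integrable g P := SignedMeasure.integrable_rnDeriv _ _
  have hg : MemLp g 2 P := by
    rw [memLp_two_iff_integrable_sq hgm.aestronglyMeasurable]
    refine ⟨by fun_prop, ?_⟩
    rw [hasFiniteIntegral_iff_ofReal (ae_of_all _ fun x => sq_nonneg _)]
    rw [rate, if_pos hac] at hG
    refine lt_top_iff_ne_top.2 fun h => hG ?_
    rw [← hgdef, h]
    simp
  refine ⟨g, hgm, hg, ?_, ?_, ?_⟩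
  · rw [← G.mass_eq_zero, ← hd, withDensityᵥ_apply hgi MeasurableSet.univ, setIntegral_univ]
  · intro f
    rw [evalMap, ← hd]
    exact integral_withDensityᵥ_lsmul (hΘm f f.2) hgm hgi ((hΘ f f.2).integrable_mul hg)
  · rw [rate, if_pos hac, ← hgdef, lintegral_ofReal_sq hg, two_inv_mul_ofReal]

/-! ### Empirical measures, sample means and normalized deviations -/

/-- The mean of `f` over the points `x 0, …, x (n - 1)`. -/
def sampleMean {n : ℕ} (x : Fin n → S) (f : S → ℝ) : ℝ := (∑ i, f (x i)) / n

theorem integrable_empirical {n : ℕ} (x : Fin n → S) {f : S → ℝ} (hf : Measurable f) :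
    Integrable f (empirical x) := by
  unfold empirical
  refine Integrable.smul_measure_nnreal (integrable_finsetSum_measure.2 fun i _ => ?_)
  exact integrable_dirac' hf.stronglyMeasurable (by simp)

theorem integral_empirical {n : ℕ} (x : Fin n → S) {f : S → ℝ} (hf : Measurable f) :
    ∫ s, f s ∂(empirical x) = sampleMean x f := by
  unfold empirical sampleMean
  rw [integral_smul_nnreal_measure, integral_finsetSum_measure]
  · simp_rw [integral_dirac' f _ hf.stronglyMeasurable]
    simp [NNReal.smul_def, div_eq_inv_mul]
  · intro i _
    exact integrable_dirac' hf.stronglyMeasurable (by simp)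

theorem isProbabilityMeasure_empirical {n : ℕ} (hn : n ≠ 0) (x : Fin n → S) :
    IsProbabilityMeasure (empirical x) := by
  constructor
  have : ((n : ℝ≥0) : ℝ≥0∞)  ≠ 0 := by simpa using hn
  simp only [empirical, Measure.smul_apply, Measure.finsetSum_apply, measure_univ,
    Finset.sum_const, Finset.card_univ, Fintype.card_fin, nsmul_eq_mul, mul_one]
  rw [ENNReal.smul_def, smul_eq_mul, ENNReal.coe_inv (by simpa using hn)]
  simpa using ENNReal.inv_mul_cancel this (by simp)

/-- The normalized deviation `(P* f - P̂ f) / a` of the bootstrap sample `y` from the sample `x`. -/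
def deviation {n k : ℕ} (x : Fin n → S) (a : ℝ) (f : S → ℝ) (y : Fin k → S) : ℝ :=
  (sampleMean y f - sampleMean x f) / a

/-- The signed measure `(P* - P̂) / a` as an element of `Λ_{0Θ}`. -/
def deviationMeasure {Θ : Set (S → ℝ)} (hΘ : ∀ f ∈ Θ, Measurable f) {n k : ℕ} (hn : n ≠ 0)
    (hk : k ≠ 0) (x : Fin n → S) (a : ℝ) (y : Fin k → S) : ZeroMassMeasure Θ where
  val := a⁻¹ • ((empirical y).toSignedMeasure - (empirical x).toSignedMeasure)
  mass_eq_zero := by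
    have := isProbabilityMeasure_empirical hn x
    have := isProbabilityMeasure_empirical hk y
    simp
  integrable f hf := by
    refine VectorMeasure.Integrable.smul_vectorMeasure
      (VectorMeasure.Integrable.sub_vectorMeasure ?_ ?_) a⁻¹
    · simpa [VectorMeasure.Integrable] using integrable_empirical y (hΘ f hf)
    · simpa [VectorMeasure.Integrable] using integrable_empirical x (hΘ f hf)

theorem evalMap_deviationMeasure {Θ : Set (S → ℝ)} (hΘ : ∀ f ∈ Θ, Measurable f) {n k : ℕ}
    (hn : n ≠ 0) (hk : k ≠ 0) (x : Fin n → S) (a : ℝ) (y : Fin k → S) (f : Θ) :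
    evalMap Θ (deviationMeasure hΘ hn hk x a y) f = deviation x a f y := by
  have hf := hΘ f f.2
  rw [evalMap, deviationMeasure, VectorMeasure.integral_smul_vectorMeasure,
    VectorMeasure.integral_sub_vectorMeasure, integral_toSignedMeasure_lsmul,
    integral_toSignedMeasure_lsmul, integral_empirical _ hf, integral_empirical _ hf, deviation,
    smul_eq_mul, div_eq_inv_mul]
  · simpa [VectorMeasure.Integrable] using integrable_empirical y hf
  · simpa [VectorMeasure.Integrable] using integrable_empirical x hf

/-- The measure `G` in the event is forced to be `(P* - P̂) / a`, so the existential turns into a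
preimage. -/
theorem bootstrapEvent_eq {Θ : Set (S → ℝ)} (hΘ : ∀ f ∈ Θ, Measurable f) {n k : ℕ}
    (hn : n ≠ 0) (hk : k ≠ 0) (x : Fin n → S) {a : ℝ} (ha : a ≠ 0)
    (A : Set (ZeroMassMeasure Θ)) :
    bootstrapEvent x k a A = {y | deviationMeasure hΘ hn hk x a y ∈ A} := by
  ext y
  simp only [bootstrapEvent, Set.mem_ofPred_eq]
  constructor
  · rintro ⟨G, hG, h⟩
    convert hG using 1
    refine ZeroMassMeasure.ext ?_
    change a⁻¹ • ((empirical y).toSignedMeasure - (empirical x).toSignedMeasure) = G.val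
    rw [h, add_sub_cancel_left, smul_smul, inv_mul_cancel₀ ha, one_smul]
  · intro h
    refine ⟨_, h, ?_⟩
    rw [deviationMeasure, smul_smul, mul_inv_cancel₀ ha, one_smul, add_sub_cancel]

@[fun_prop]
theorem measurable_sampleMean {n : ℕ} {f : S → ℝ} (hf : Measurable f) :
    Measurable (fun x : Fin n → S => sampleMean x f) := by
  unfold sampleMean
  fun_prop

@[fun_prop]
theorem measurable_deviation {n k : ℕ} (x : Fin n → S) (a : ℝ) {f : S → ℝ} (hf : Measurable f) :
    Measurable (deviation x a f : (Fin k → S) → ℝ) := by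
  unfold deviation
  fun_prop

theorem measurableSet_evalMap_preimage {Θ : Set (S → ℝ)} (f : Θ) {B : Set ℝ}
    (hB : MeasurableSet B) : MeasurableSet {G : ZeroMassMeasure Θ | evalMap Θ G f ∈ B} :=
  ⟨(fun v => v f) ⁻¹' B, (measurable_pi_apply f) hB, rfl⟩

section SampleMean

variable {n : ℕ} (x : Fin n → S)

theorem sampleMean_add (f g : S → ℝ) :
    sampleMean x (fun s => f s + g s) = sampleMean x f + sampleMean x g := by
  simp only [sampleMean, Finset.sum_add_distrib, add_div]

theorem sampleMean_sub (f g : S → ℝ) :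
    sampleMean x (fun s => f s - g s) = sampleMean x f - sampleMean x g := by
  simp only [sampleMean, Finset.sum_sub_distrib, sub_div]

theorem sampleMean_const_mul (c : ℝ) (f : S → ℝ) :
    sampleMean x (fun s => c * f s) = c * sampleMean x f := by
  simp only [sampleMean, ← Finset.mul_sum, mul_div_assoc]

theorem sampleMean_const (hn : n ≠ 0) (c : ℝ) : sampleMean x (fun _ => c) = c := by
  have : (n : ℝ) ≠ 0 := by exact_mod_cast hn
  simp [sampleMean, this]

theorem abs_sampleMean_le {f g : S → ℝ} (h : ∀ i, |f (x i)| ≤ g (x i)) :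
    |sampleMean x f| ≤ sampleMean x g := by
  unfold sampleMean
  rw [abs_div, Nat.abs_cast]
  gcongr
  exact (Finset.abs_sum_le_sum_abs _ _).trans (Finset.sum_le_sum fun i _ => h i)

theorem sampleMean_pos (hn : n ≠ 0) {f : S → ℝ} (hf : ∀ s, 0 < f s) : 0 < sampleMean x f := by
  have : NeZero n := ⟨hn⟩
  have : (0 : ℝ) < n := by exact_mod_cast Nat.pos_of_ne_zero hn
  exact div_pos (Finset.sum_pos (fun i _ => hf _) Finset.univ_nonempty) this

theorem sampleMean_sum_mul {ι : Type*} (I : Finset ι) (l : ι → ℝ) (f : ι → S → ℝ) :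
    sampleMean x (fun s => ∑ i ∈ I, l i * f i s) = ∑ i ∈ I, l i * sampleMean x (f i) := by
  classical
  induction I using Finset.induction_on with
  | empty => simp [sampleMean]
  | insert i I hi ih =>
    simp only [Finset.sum_insert hi]
    rw [sampleMean_add x (fun s => l i * f i s), sampleMean_const_mul, ih]

end SampleMean

/-! ### Exponential moments and the limit of `logMgf` -/

/-- The scaled logarithmic moment generating function of `f` under the empirical measure of `x`,
centred at its mean. -/
def logMgf {n : ℕ} (x : Fin n → S) (a : ℝ) (f : S → ℝ) : ℝ :=
  Real.log (sampleMean x fun s => Real.exp (a * (f s - sampleMean x f))) / a ^ 2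

section Deviation

variable {n k : ℕ} (x : Fin n → S) (a : ℝ) (y : Fin k → S)

theorem deviation_add (f g : S → ℝ) :
    deviation x a (fun s => f s + g s) y = deviation x a f y + deviation x a g y := by
  simp only [deviation, sampleMean_add]; ring

theorem deviation_const_mul (c : ℝ) (f : S → ℝ) :
    deviation x a (fun s => c * f s) y = c * deviation x a f y := by
  simp only [deviation, sampleMean_const_mul]; ring

theorem deviation_sum_mul {ι : Type*} (I : Finset ι) (l : ι → ℝ) (f : ι → S → ℝ) :
    deviation x a (fun s => ∑ i ∈ I, l i * f i s) y = ∑ i ∈ I, l i * deviation x a (f i) y := by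
  simp only [deviation, sampleMean_sum_mul, ← Finset.sum_sub_distrib, Finset.sum_div]
  exact Finset.sum_congr rfl fun i _ => by ring

theorem exp_deviation_eq_prod (hk : k ≠ 0) {a : ℝ} (ha : a ≠ 0) (f : S → ℝ) :
    Real.exp (k * a ^ 2 * deviation x a f y) =
      ∏ j, Real.exp (a * (f (y j) - sampleMean x f)) := by
  have : (k : ℝ) ≠ 0 := by exact_mod_cast hk
  rw [← Real.exp_sum, ← Finset.mul_sum, Finset.sum_sub_distrib]
  congr 1
  simp only [Finset.sum_const, Finset.card_univ, Fintype.card_fin, nsmul_eq_mul]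
  unfold deviation
  rw [sampleMean]
  field_simp

theorem integrable_exp_deviation (hk : k ≠ 0) {a : ℝ} (ha : a ≠ 0) {f : S → ℝ}
    (hf : Measurable f) :
    Integrable (fun y : Fin k → S => Real.exp (k * a ^ 2 * deviation x a f y))
      (Measure.pi fun _ => empirical x) := by
  simp_rw [exp_deviation_eq_prod x _ hk ha]
  exact Integrable.fintype_prod (f := fun _ s => Real.exp (a * (f s - sampleMean x f)))
    fun _ => integrable_empirical x (by fun_prop)

/-- The exponent `k * a ^ 2 * deviation` is `a` times a sum of `k` independent centred terms, so the
expectation is a `k`-th power; dividing by `a ^ 2` in `logMgf` matches the speed `k * a ^ 2`. -/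
theorem integral_exp_deviation (hn : n ≠ 0) (hk : k ≠ 0) {a : ℝ} (ha : a ≠ 0) {f : S → ℝ}
    (hf : Measurable f) :
    ∫ y : Fin k → S, Real.exp (k * a ^ 2 * deviation x a f y) ∂(Measure.pi fun _ => empirical x) =
      Real.exp (k * a ^ 2 * logMgf x a f) := by
  simp_rw [exp_deviation_eq_prod x _ hk ha]
  rw [integral_fintype_prod_eq_pow (fun s => Real.exp (a * (f s - sampleMean x f))),
    integral_empirical x (by fun_prop), Fintype.card_fin, logMgf]
  have hpos : 0 < sampleMean x fun s => Real.exp (a * (f s - sampleMean x f)) :=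
    sampleMean_pos x hn fun _ => Real.exp_pos _
  rw [mul_div_assoc', mul_assoc, mul_div_assoc, mul_div_cancel_left₀ _ (pow_ne_zero 2 ha),
    Real.exp_nat_mul, Real.exp_log hpos]

end Deviation

theorem abs_exp_sub_quadratic_le {t ε : ℝ} (ht : |t| ≤ ε) (hε : ε ≤ 1) :
    |Real.exp t - 1 - t - t ^ 2 / 2| ≤ ε * t ^ 2 := by
  have h := Real.exp_bound (ht.trans hε) (n := 3) (by norm_num)
  simp only [Finset.sum_range_succ, Finset.sum_range_zero, Nat.factorial] at h
  norm_num at h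
  have e : Real.exp t - 1 - t - t ^ 2 / 2 = Real.exp t - (1 + t + t ^ 2 / 2) := by ring
  rw [e]
  refine h.trans ?_
  have h3 : |t| ^ 3 = |t| * t ^ 2 := by rw [pow_succ', sq_abs]
  rw [h3]
  have : |t| * t ^ 2 ≤ ε * t ^ 2 := by gcongr
  nlinarith [mul_nonneg (abs_nonneg t) (sq_nonneg t)]

/-- The quadratic Taylor estimate is averaged over the sample; centring kills the linear term. -/
theorem abs_sampleMean_exp_sub_le {n : ℕ} (hn : n ≠ 0) (x : Fin n → S) (a : ℝ) (f : S → ℝ) {ε : ℝ}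
    (hε : ε ≤ 1) (h : ∀ i, |a * (f (x i) - sampleMean x f)| ≤ ε) :
    |(sampleMean x fun s => Real.exp (a * (f s - sampleMean x f))) - 1 -
        a ^ 2 * ((sampleMean x fun s => f s ^ 2) - sampleMean x f ^ 2) / 2| ≤
      ε * (a ^ 2 * ((sampleMean x fun s => f s ^ 2) - sampleMean x f ^ 2)) := by
  set m := sampleMean x f with hm
  have hsq : sampleMean x (fun s => (a * (f s - m)) ^ 2) =
      a ^ 2 * ((sampleMean x fun s => f s ^ 2) - m ^ 2) := by
    have : (fun s => (a * (f s - m)) ^ 2) =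
        fun s => (a ^ 2 * f s ^ 2 - (2 * a ^ 2 * m) * f s) + a ^ 2 * m ^ 2 := by
      funext s; ring
    rw [this, sampleMean_add, sampleMean_sub, sampleMean_const_mul, sampleMean_const_mul,
      sampleMean_const x hn, ← hm]
    ring
  have hlin : sampleMean x (fun s => a * (f s - m)) = 0 := by
    rw [sampleMean_const_mul, sampleMean_sub, sampleMean_const x hn, ← hm, sub_self, mul_zero]
  have key := abs_sampleMean_le x
    (f := fun s => Real.exp (a * (f s - m)) - 1 - a * (f s - m) - 2⁻¹ * (a * (f s - m)) ^ 2)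
    (g := fun s => ε * (a * (f s - m)) ^ 2)
    (fun i => by
      have := abs_exp_sub_quadratic_le (h i) hε
      rwa [div_eq_inv_mul] at this)
  rw [sampleMean_sub, sampleMean_sub, sampleMean_sub, sampleMean_const x hn, hlin,
    sampleMean_const_mul, sampleMean_const_mul, hsq] at key
  convert key using 2
  ring

/-- Since all `a n * (f (z i) - mean)` with `i < n` are uniformly small, the averaged exponential `E
n` is `1 + a n ^ 2 * V n / 2 + o(a n ^ 2)`, where `V n` is the sample variance. The logarithm is
then squeezed by `1 - E⁻¹ ≤ log E ≤ E - 1`. -/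
theorem tendsto_logMgf {z : ℕ → S} {f : S → ℝ} {m q : ℝ} {a : ℕ → ℝ}
    (ha : Tendsto a atTop (𝓝 0)) (hapos : ∀ n, 1 ≤ n → 0 < a n)
    (hm : Tendsto (fun n : ℕ => sampleMean (fun i : Fin n => z i) f) atTop (𝓝 m))
    (hq : Tendsto (fun n : ℕ => sampleMean (fun i : Fin n => z i) fun s => f s ^ 2) atTop (𝓝 q))
    (hmax : ∀ ε > 0, ∀ᶠ n in atTop, ∀ i < n, a n * |f (z i)| ≤ ε) :
    Tendsto (fun n : ℕ => logMgf (fun i : Fin n => z i) (a n) f) atTop (𝓝 ((q - m ^ 2) / 2)) := by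
  set V : ℕ → ℝ := fun n => (sampleMean (fun i : Fin n => z i) fun s => f s ^ 2) -
    sampleMean (fun i : Fin n => z i) f ^ 2 with hVdef
  set E : ℕ → ℝ := fun n => sampleMean (fun i : Fin n => z i)
    fun s => Real.exp (a n * (f s - sampleMean (fun i : Fin n => z i) f)) with hEdef
  have hV : Tendsto V atTop (𝓝 (q - m ^ 2)) := hq.sub (hm.pow 2)
  have hE1 : Tendsto (fun n => (E n - 1) / a n ^ 2) atTop (𝓝 ((q - m ^ 2) / 2)) := by
    have hdiff : Tendsto (fun n => (E n - 1) / a n ^ 2 - V n / 2) atTop (𝓝 0) := by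
      rw [Metric.tendsto_atTop']
      intro δ hδ
      obtain ⟨K, hK⟩ : ∃ K, q - m ^ 2 < K := exists_gt _
      -- The cap `1` is needed for the Taylor estimate; the other entry gives `ε * V n < δ` once `V
      -- n < K`.
      set ε := min 1 (δ / (2 * (|K| + 1))) with hεdef
      have hε : 0 < ε := by positivity
      have hbd : Tendsto (fun n => a n * |sampleMean (fun i : Fin n => z i) f|) atTop (𝓝 0) := by
        simpa using ha.mul hm.abs
      have hev : ∀ᶠ n in atTop, |(E n - 1) / a n ^ 2 - V n / 2| < δ := by
        filter_upwards [hmax (ε / 2) (by positivity), hbd.eventually (gt_mem_nhds (half_pos hε)),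
          hV.eventually (gt_mem_nhds hK), eventually_ge_atTop 1] with n h1 h2 h3 h4
        have hpos := hapos n h4
        have := abs_sampleMean_exp_sub_le (by lia) (fun i : Fin n => z i) (a n) f
          (min_le_left 1 (δ / (2 * (|K| + 1)))) (fun i => by
            rw [abs_mul, abs_of_pos hpos]
            have := h1 i i.2
            have h5 := abs_sub (f (z i)) (sampleMean (fun i : Fin n => z i) f)
            nlinarith)
        change |E n - 1 - a n ^ 2 * V n / 2| ≤ ε * (a n ^ 2 * V n) at this
        have e : (E n - 1) / a n ^ 2 - V n / 2 = (E n - 1 - a n ^ 2 * V n / 2) / a n ^ 2 := by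
          field_simp
        rw [e, abs_div, abs_of_pos (pow_pos hpos 2), div_lt_iff₀ (pow_pos hpos 2)]
        refine this.trans_lt ?_
        have hVK : ε * V n < δ := by
          have : ε * V n ≤ ε * (|K| + 1) := by
            gcongr
            linarith [le_abs_self K]
          have h6 : ε * (|K| + 1) ≤ δ / (2 * (|K| + 1)) * (|K| + 1) := by
            gcongr
            exact min_le_right _ _
          have h7 : δ / (2 * (|K| + 1)) * (|K| + 1) = δ / 2 := by
            field_simp
          linarith
        nlinarith [pow_pos hpos 2]
      obtain ⟨N, hN⟩ := eventually_atTop.1 hev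
      exact ⟨N, fun n hn => by simpa [Real.dist_eq] using hN n hn.le⟩
    simpa using hdiff.add (hV.div_const 2)
  have hEt : Tendsto E atTop (𝓝 1) := by
    have : Tendsto (fun n => a n ^ 2 * ((E n - 1) / a n ^ 2) + 1) atTop (𝓝 1) := by
      simpa using ((ha.pow 2).mul hE1).add_const 1
    refine this.congr' ?_
    filter_upwards [eventually_ge_atTop 1] with n hn
    have := (hapos n hn).ne'
    field_simp
    ring
  have hlow : Tendsto (fun n => (E n - 1) / a n ^ 2 / E n) atTop (𝓝 ((q - m ^ 2) / 2)) := by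
    have := hE1.div hEt one_ne_zero
    rwa [div_one] at this
  refine tendsto_of_tendsto_of_tendsto_of_le_of_le' hlow hE1 ?_ ?_
  · filter_upwards [eventually_ge_atTop 1] with n hn
    have hpos : 0 < E n := sampleMean_pos _ (by lia) fun _ => Real.exp_pos _
    have h2 := pow_pos (hapos n hn) 2
    change _ ≤ Real.log (E n) / a n ^ 2
    rw [div_div, mul_comm, ← div_div]
    gcongr
    have := Real.one_sub_inv_le_log_of_pos hpos
    have e : (E n - 1) / E n = 1 - (E n)⁻¹ := by field_simp
    rwa [e]
  · filter_upwards [eventually_ge_atTop 1] with n hn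
    have hpos : 0 < E n := sampleMean_pos _ (by lia) fun _ => Real.exp_pos _
    change Real.log (E n) / a n ^ 2 ≤ _
    gcongr
    exact Real.log_le_sub_one_of_pos hpos

/-! ### Strong law and admissible functions -/

section Sampling

variable {Υ : Type*} [MeasurableSpace Υ] {μ : Measure Υ} {P : Measure S}
  {X : ℕ → Υ → S}

theorem ae_tendsto_sampleMean (hX : ∀ i, Measurable (X i)) (hindep : iIndepFun X μ)
    (hlaw : ∀ i, μ.map (X i) = P) {f : S → ℝ} (hf : Measurable f) (hfi : Integrable f P) :
    ∀ᵐ ω ∂μ, Tendsto (fun n => sampleMean (sample X n ω) f) atTop (𝓝 (∫ s, f s ∂P)) := by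
  have h := strong_law_ae_real (μ := μ) (fun i ω => f (X i ω))
    (by
      rw [← hlaw 0] at hfi
      exact hfi.comp_measurable (hX 0))
    (fun i j hij => (hindep.indepFun hij).comp hf hf)
    (fun i => (⟨(hX i).aemeasurable, (hX 0).aemeasurable, by rw [hlaw, hlaw]⟩ :
      IdentDistrib (X i) (X 0) μ μ).comp hf)
  have e : ∫ ω, f (X 0 ω) ∂μ = ∫ s, f s ∂P := by
    rw [← hlaw 0, integral_map (hX 0).aemeasurable hf.aestronglyMeasurable]
  rw [e] at h
  filter_upwards [h] with ω hω
  refine hω.congr fun n => ?_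
  rw [sampleMean, ← Fin.sum_univ_eq_sum_range (fun i => f (X i ω)) n]
  rfl

@[fun_prop]
theorem measurable_sample (hX : ∀ i, Measurable (X i)) (n : ℕ) : Measurable (sample X n) :=
  measurable_pi_lambda _ fun i => hX i

theorem measurable_logMgf {n : ℕ} (a : ℝ) {f : S → ℝ} (hf : Measurable f) :
    Measurable (fun x : Fin n → S => logMgf x a f) := by
  have h : Measurable (fun x : Fin n → S =>
      sampleMean x fun s => Real.exp (a * (f s - sampleMean x f))) := by
    have hm := measurable_sampleMean (n := n) hf
    unfold sampleMean at hm ⊢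
    fun_prop
  unfold logMgf
  fun_prop

/-- Square integrable functions whose sample maxima are almost surely `o((a n)⁻¹)`. -/
structure IsAdmissible (μ : Measure Υ) (X : ℕ → Υ → S) (P : Measure S) (a : ℕ → ℝ)
    (f : S → ℝ) : Prop where
  measurable : Measurable f
  memLp : MemLp f 2 P
  max_small : ∀ᵐ ω ∂μ, ∀ ε > 0, ∀ᶠ n in atTop, ∀ i < n, a n * |f (X i ω)| ≤ ε

theorem IsAdmissible.add {a : ℕ → ℝ} (hapos : ∀ n, 1 ≤ n → 0 < a n) {f g : S → ℝ}
    (hf : IsAdmissible μ X P a f) (hg : IsAdmissible μ X P a g) :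
    IsAdmissible μ X P a (fun s => f s + g s) where
  measurable := hf.measurable.add hg.measurable
  memLp := hf.memLp.add hg.memLp
  max_small := by
    filter_upwards [hf.max_small, hg.max_small] with ω h1 h2 ε hε
    filter_upwards [h1 (ε / 2) (by positivity), h2 (ε / 2) (by positivity)] with n k1 k2 i hi
    have := k1 i hi
    have := k2 i hi
    have := hapos n (by lia)
    have := abs_add_le (f (X i ω)) (g (X i ω))
    nlinarith

theorem IsAdmissible.const_mul {a : ℕ → ℝ} {f : S → ℝ} (hf : IsAdmissible μ X P a f) (c : ℝ) :
    IsAdmissible μ X P a (fun s => c * f s) where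
  measurable := hf.measurable.const_mul c
  memLp := hf.memLp.const_mul c
  max_small := by
    filter_upwards [hf.max_small] with ω h1 ε hε
    filter_upwards [h1 (ε / (|c| + 1)) (by positivity)] with n k1 i hi
    rw [abs_mul]
    calc a n * (|c| * |f (X i ω)|) = |c| * (a n * |f (X i ω)|) := by ring
      _ ≤ |c| * (ε / (|c| + 1)) := by gcongr; exact k1 i hi
      _ = ε * (|c| / (|c| + 1)) := by ring
      _ ≤ ε * 1 := by
        gcongr
        rw [div_le_one (by positivity)]
        linarith
      _ = ε := mul_one _

theorem IsAdmissible.sum_mul {a : ℕ → ℝ} (hapos : ∀ n, 1 ≤ n → 0 < a n) {ι : Type*} (I : Finset ι)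
    (l : ι → ℝ) {f : ι → S → ℝ} (hf : ∀ i ∈ I, IsAdmissible μ X P a (f i)) :
    IsAdmissible μ X P a (fun s => ∑ i ∈ I, l i * f i s) := by
  classical
  induction I using Finset.induction_on with
  | empty =>
    refine ⟨by simp, by simp, ae_of_all _ fun ω ε hε => ?_⟩
    simp [hε.le]
  | insert i I hi ih =>
    simp only [Finset.sum_insert hi]
    exact ((hf i (by simp)).const_mul (l i)).add hapos
      (ih fun j hj => hf j (Finset.mem_insert_of_mem hj))

theorem IsAdmissible.ae_tendsto_logMgf [IsProbabilityMeasure P] (hX : ∀ i, Measurable (X i))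
    (hindep : iIndepFun X μ) (hlaw : ∀ i, μ.map (X i) = P) {a : ℕ → ℝ}
    (ha : Tendsto a atTop (𝓝 0)) (hapos : ∀ n, 1 ≤ n → 0 < a n) {f : S → ℝ}
    (hf : IsAdmissible μ X P a f) :
    ∀ᵐ ω ∂μ, Tendsto (fun n => logMgf (sample X n ω) (a n) f) atTop
      (𝓝 (Var[f; P] / 2)) := by
  filter_upwards [ae_tendsto_sampleMean hX hindep hlaw hf.measurable
    (hf.memLp.integrable (by norm_num)), ae_tendsto_sampleMean hX hindep hlaw
    (hf.measurable.pow_const 2) hf.memLp.integrable_sq, hf.max_small] with ω h1 h2 h3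
  rw [variance_eq_sub hf.memLp]
  exact tendsto_logMgf (z := fun i => X i ω) ha hapos h1 h2 h3

end Sampling

/-! ### Inner almost sure bounds from convergence of `logMgf` -/

section InnerAS

variable {Υ : Type*} [MeasurableSpace Υ] {μ : Measure Υ}

/-- The measurable minorant is the supremum over rationals `q < c` of the function equal to `q` on
`E q n` and `⊥` elsewhere. Countability of the rationals keeps it measurable and lets the null sets
be united. -/
theorem liminfGeInnerAS_of_forall_lt {Z : ℕ → Υ → EReal} {c : EReal}
    (h : ∀ r : ℝ, (r : EReal) < c → ∃ E : ℕ → Set Υ, (∀ n, MeasurableSet (E n)) ∧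
      (∀ n, ∀ ω ∈ E n, (r : EReal) ≤ Z n ω) ∧ ∀ᵐ ω ∂μ, ∀ᶠ n in atTop, ω ∈ E n) :
    LiminfGeInnerAS μ Z c := by
  classical
  have h' : ∀ q : {q : ℚ // ((q : ℝ) : EReal) < c}, ∃ E : ℕ → Set Υ, (∀ n, MeasurableSet (E n)) ∧
      (∀ n, ∀ ω ∈ E n, ((q : ℝ) : EReal) ≤ Z n ω) ∧ ∀ᵐ ω ∂μ, ∀ᶠ n in atTop, ω ∈ E n :=
    fun q => h q q.2
  choose E hEm hEZ hEae using h'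
  refine ⟨fun n ω => ⨆ q, if ω ∈ E q n then ((q : ℝ) : EReal) else ⊥, fun n => ?_, fun n ω => ?_, ?_⟩
  · exact Measurable.iSup fun q => Measurable.ite (hEm q n) measurable_const measurable_const
  · refine iSup_le fun q => ?_
    split_ifs with hω
    · exact hEZ q n ω hω
    · exact bot_le
  · filter_upwards [ae_all_iff.2 hEae] with ω hω
    refine le_of_forall_lt_imp_le_of_dense fun b hb => ?_
    obtain ⟨q, hbq, hqc⟩ := EReal.exists_rat_btwn_of_lt hb
    refine hbq.le.trans (le_liminf_of_le (by isBoundedDefault) ?_)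
    filter_upwards [hω ⟨q, hqc⟩] with n hn
    refine le_iSup_of_le ⟨q, hqc⟩ ?_
    rw [if_pos hn]

theorem liminfGeInnerAS_of_logMgf {P : Measure S} [IsProbabilityMeasure P] {X : ℕ → Υ → S}
    (hX : ∀ i, Measurable (X i)) (hindep : iIndepFun X μ) (hlaw : ∀ i, μ.map (X i) = P)
    {a : ℕ → ℝ} (ha : Tendsto a atTop (𝓝 0)) (hapos : ∀ n, 1 ≤ n → 0 < a n)
    {Z : ℕ → Υ → EReal} {c : EReal}
    (h : ∀ r : ℝ, (r : EReal) < c → ∃ F : Finset (S → ℝ), (∀ φ ∈ F, IsAdmissible μ X P a φ) ∧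
      ∃ ε > 0, ∀ᶠ n in atTop, ∀ ω,
        (∀ φ ∈ F, |logMgf (sample X n ω) (a n) φ - Var[φ; P] / 2| < ε) → (r : EReal) ≤ Z n ω) :
    LiminfGeInnerAS μ Z c := by
  refine liminfGeInnerAS_of_forall_lt fun r hr => ?_
  obtain ⟨F, hF, ε, hε, hev⟩ := h r hr
  obtain ⟨N, hN⟩ := eventually_atTop.1 hev
  -- The factor `N ≤ n` makes the set empty for early `n`, where no bound on `Z n` is available.
  refine ⟨fun n => {_ω | N ≤ n} ∩
      ⋂ φ ∈ F, {ω | |logMgf (sample X n ω) (a n) φ - Var[φ; P] / 2| < ε},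
    fun n => ?_, fun n ω hω => hN n hω.1 ω (by simpa using hω.2), ?_⟩
  · refine MeasurableSet.inter (MeasurableSet.const (N ≤ n))
      (Finset.measurableSet_biInter F fun φ hφ => ?_)
    have := (measurable_logMgf (n := n) (a n) (hF φ hφ).measurable).comp (measurable_sample hX n)
    exact measurableSet_lt (by fun_prop) measurable_const
  · have : ∀ᵐ ω ∂μ, ∀ φ ∈ F, Tendsto (fun n => logMgf (sample X n ω) (a n) φ) atTop
        (𝓝 (Var[φ; P] / 2)) :=
      (ae_ball_iff F.countable_toSet).2 fun φ hφ =>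
        (hF φ hφ).ae_tendsto_logMgf hX hindep hlaw ha hapos
    filter_upwards [this] with ω hω
    have hall : ∀ᶠ n in atTop, ∀ φ ∈ F, |logMgf (sample X n ω) (a n) φ - Var[φ; P] / 2| < ε :=
      (Finset.eventually_all F).2 fun φ hφ => by
        have := (Metric.tendsto_nhds.1 (hω φ hφ)) ε hε
        simpa [Real.dist_eq] using this
    filter_upwards [eventually_ge_atTop N, hall] with n h1 h2
    exact ⟨h1, by simpa using h2⟩

end InnerAS

/-! ### Projection in `L²` and the optimal tilt -/

theorem exists_combination_inner_eq {E ι : Type*} [NormedAddCommGroup E] [InnerProductSpace ℝ E]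
    [Fintype ι] (e : ι → E) (g : E) :
    ∃ l : ι → ℝ, (∀ j, inner ℝ (∑ i, l i • e i) (e j) = inner ℝ g (e j)) ∧
      ‖∑ i, l i • e i‖ ≤ ‖g‖ := by
  set K := Submodule.span ℝ (Set.range e)
  have : FiniteDimensional ℝ K := FiniteDimensional.span_of_finite ℝ (Set.finite_range e)
  obtain ⟨l, hl⟩ := (Submodule.mem_span_range_iff_exists_fun ℝ).1
    (K.starProjection_apply_mem g)
  refine ⟨l, fun j => ?_, ?_⟩
  · rw [hl]
    have := Submodule.starProjection_inner_eq_zero (K := K) g (e j)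
      (Submodule.subset_span (Set.mem_range_self j))
    rw [inner_sub_left] at this
    linarith
  · rw [hl]
    exact K.norm_starProjection_apply_le g

/-- The centring of a square integrable function, as an element of `L²`. -/
def centered (P : Measure S) [IsProbabilityMeasure P] {f : S → ℝ} (hf : MemLp f 2 P) : Lp ℝ 2 P :=
  (hf.sub (memLp_const (∫ s, f s ∂P))).toLp

theorem inner_centered (P : Measure S) [IsProbabilityMeasure P] {f g : S → ℝ} (hf : MemLp f 2 P)
    (hg : MemLp g 2 P) : inner ℝ (centered P hf) (centered P hg) = cov[f, g; P] := by
  rw [L2.inner_def, covariance]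
  refine integral_congr_ae ?_
  filter_upwards [(hf.sub (memLp_const (∫ s, f s ∂P))).coeFn_toLp,
    (hg.sub (memLp_const (∫ s, g s ∂P))).coeFn_toLp] with s h1 h2
  rw [centered, centered, h1, h2]
  simp [mul_comm]

theorem inner_toLp_centered (P : Measure S) [IsProbabilityMeasure P] {f g : S → ℝ}
    (hf : MemLp f 2 P) (hg : MemLp g 2 P) (hg0 : ∫ s, g s ∂P = 0) :
    inner ℝ (hg.toLp g) (centered P hf) = ∫ s, f s * g s ∂P := by
  rw [L2.inner_def]
  have : ∫ s, f s * g s ∂P = ∫ s, (f s * g s - (∫ s, f s ∂P) * g s) ∂P := by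
    have hfg : Integrable (fun s => f s * g s) P := hf.integrable_mul hg
    rw [integral_sub hfg ((hg.integrable (by norm_num)).const_mul _),
      integral_const_mul, hg0, mul_zero, sub_zero]
  rw [this]
  refine integral_congr_ae ?_
  filter_upwards [(hf.sub (memLp_const (∫ s, f s ∂P))).coeFn_toLp, hg.coeFn_toLp] with s h1 h2
  rw [centered, h1, h2]
  simp
  ring

theorem norm_toLp_sq {P : Measure S} {g : S → ℝ} (hg : MemLp g 2 P) :
    ‖hg.toLp g‖ ^ 2 = ∫ s, g s ^ 2 ∂P := by
  rw [← real_inner_self_eq_norm_sq, L2.inner_def]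
  refine integral_congr_ae ?_
  filter_upwards [hg.coeFn_toLp] with s hs
  rw [hs]
  simp [sq]

/-- The orthogonal projection of `g` onto the span of the centred `f i` keeps the pairings and does
not increase the norm. Its coefficients `l` are the tilt of the lower bound. -/
theorem exists_combination_cov_eq {P : Measure S} [IsProbabilityMeasure P] {ι : Type*} [Fintype ι]
    {f : ι → S → ℝ} (hf : ∀ i, MemLp (f i) 2 P) {g : S → ℝ} (hg : MemLp g 2 P)
    (hg0 : ∫ s, g s ∂P = 0) :
    ∃ l : ι → ℝ, (∀ j, cov[fun s => ∑ i, l i * f i s, f j; P] = ∫ s, f j s * g s ∂P) ∧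
      Var[fun s => ∑ i, l i * f i s; P] ≤ ∫ s, g s ^ 2 ∂P := by
  obtain ⟨l, h1, h2⟩ := exists_combination_inner_eq (fun i => centered P (hf i)) (hg.toLp g)
  have hcov : ∀ φ : S → ℝ, MemLp φ 2 P → cov[fun s => ∑ i, l i * f i s, φ; P] =
      ∑ i, l i * cov[f i, φ; P] := fun φ hφ => by
    rw [covariance_fun_sum_left (fun i => (hf i).const_mul _) hφ]
    simp_rw [covariance_const_mul_left]
  have hu : MemLp (fun s => ∑ i, l i * f i s) 2 P :=
    memLp_finsetSum _ fun i _ => (hf i).const_mul _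
  refine ⟨l, fun j => ?_, ?_⟩
  · rw [hcov _ (hf j), ← inner_toLp_centered P (hf j) hg hg0, ← h1 j, sum_inner]
    simp_rw [inner_smul_left, inner_centered]
    simp
  · rw [← covariance_self hu.aemeasurable, hcov _ hu]
    simp_rw [covariance_comm (f _) (fun s => _), hcov _ (hf _)]
    have e1 : ∑ i, l i * ∑ j, l j * cov[f j, f i; P] = ‖∑ i, l i • centered P (hf i)‖ ^ 2 := by
      rw [← real_inner_self_eq_norm_sq, inner_sum]
      simp_rw [inner_smul_right, sum_inner, inner_smul_left, inner_centered]
      simp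
    rw [e1, ← norm_toLp_sq hg]
    gcongr

/-! ### Finite-dimensional lower bound -/

section LowerBound

variable {ι : Type*} [Fintype ι]

/-- The left side is the expectation of `exp (t * deviation u)` with `u = ∑ l i * f i` and `t = k *
a ^ 2`. Inside the box the integrand is bounded by a constant. Outside, some coordinate leaves by at
least `δ`, and the integrand may be multiplied by `exp (t * η * (± (deviation - v i) - δ)) ≥ 1`,
which is a Chernoff bound under the tilt `u`. -/
theorem exp_logMgf_le_prob_add {n k : ℕ} (hn : n ≠ 0) (hk : k ≠ 0) (x : Fin n → S) {a : ℝ}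
    (ha : 0 < a) {f : ι → S → ℝ} (hf : ∀ i, Measurable (f i)) (l v : ι → ℝ) {δ η : ℝ}
    (hη : 0 ≤ η) :
    Real.exp (k * a ^ 2 * logMgf x a fun s => ∑ i, l i * f i s) ≤
      Real.exp (k * a ^ 2 * (∑ i, l i * v i + δ * ∑ i, |l i|)) *
        (Measure.pi fun _ : Fin k => empirical x).real {y | ∀ i, |deviation x a (f i) y - v i| < δ} +
      ∑ i, (Real.exp (k * a ^ 2 * (logMgf x a fun s => (∑ i, l i * f i s) + η * f i s)) *
          Real.exp (-(k * a ^ 2 * (η * (v i + δ)))) +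
        Real.exp (k * a ^ 2 * (logMgf x a fun s => (∑ i, l i * f i s) + -η * f i s)) *
          Real.exp (k * a ^ 2 * (η * (v i - δ)))) := by
  classical
  have := isProbabilityMeasure_empirical hn x
  set ν := Measure.pi fun _ : Fin k => empirical x with hν
  set t : ℝ := k * a ^ 2 with ht
  have ht0 : 0 ≤ t := by positivity
  set u : S → ℝ := fun s => ∑ i, l i * f i s with hu
  have hum : Measurable u := by fun_prop
  have hup : ∀ i, Measurable (fun s => u s + η * f i s) := fun i => by fun_prop
  have hdn : ∀ i, Measurable (fun s => u s + -η * f i s) := fun i => by fun_prop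
  set A : Set (Fin k → S) := {y | ∀ i, |deviation x a (f i) y - v i| < δ} with hA
  have hAm : MeasurableSet A := by
    have : A = ⋂ i, {y | |deviation x a (f i) y - v i| < δ} := by ext; simp [hA]
    rw [this]
    exact MeasurableSet.iInter fun i => measurableSet_lt (by fun_prop) measurable_const
  have hpt : ∀ y : Fin k → S, Real.exp (t * deviation x a u y) ≤
      A.indicator (fun _ => Real.exp (t * (∑ i, l i * v i + δ * ∑ i, |l i|))) y +
      ∑ i, (Real.exp (t * deviation x a (fun s => u s + η * f i s) y) *
          Real.exp (-(t * (η * (v i + δ)))) +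
        Real.exp (t * deviation x a (fun s => u s + -η * f i s) y) *
          Real.exp (t * (η * (v i - δ)))) := by
    intro y
    have hsum0 : ∀ i ∈ Finset.univ, 0 ≤
        (Real.exp (t * deviation x a (fun s => u s + η * f i s) y) *
          Real.exp (-(t * (η * (v i + δ)))) +
        Real.exp (t * deviation x a (fun s => u s + -η * f i s) y) *
          Real.exp (t * (η * (v i - δ)))) := fun i _ => by positivity
    by_cases hy : y ∈ A
    · rw [Set.indicator_of_mem hy]
      refine le_add_of_le_of_nonneg ?_ (Finset.sum_nonneg hsum0)
      gcongr
      rw [hu, deviation_sum_mul, Finset.mul_sum, ← Finset.sum_add_distrib]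
      refine Finset.sum_le_sum fun i _ => ?_
      have h1 : l i * (deviation x a (f i) y - v i) ≤ |l i| * δ := by
        refine (le_abs_self _).trans ?_
        rw [abs_mul]
        exact mul_le_mul_of_nonneg_left (hy i).le (abs_nonneg _)
      linarith
    · rw [Set.indicator_of_notMem hy, zero_add]
      have hy' : ∃ i, δ ≤ |deviation x a (f i) y - v i| := by
        simpa [hA] using hy
      obtain ⟨i, hi⟩ := hy'
      refine le_trans ?_ (Finset.single_le_sum hsum0 (Finset.mem_univ i))
      rw [← Real.exp_add, ← Real.exp_add]
      rcases le_abs.1 hi with h | h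
      · refine le_add_of_le_of_nonneg ?_ (Real.exp_pos _).le
        rw [deviation_add, deviation_const_mul]
        gcongr
        nlinarith [mul_nonneg (mul_nonneg ht0 hη) (sub_nonneg.2 h)]
      · refine le_add_of_nonneg_of_le (Real.exp_pos _).le ?_
        rw [deviation_add, deviation_const_mul]
        gcongr
        nlinarith [mul_nonneg (mul_nonneg ht0 hη) (sub_nonneg.2 h)]
  have hi1 : ∀ φ : S → ℝ, Measurable φ →
      Integrable (fun y : Fin k → S => Real.exp (t * deviation x a φ y)) ν :=
    fun φ hφ => integrable_exp_deviation x hk ha.ne' hφ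
  have hi2 : ∀ φ : S → ℝ, Measurable φ →
      ∫ y : Fin k → S, Real.exp (t * deviation x a φ y) ∂ν = Real.exp (t * logMgf x a φ) :=
    fun φ hφ => integral_exp_deviation x hn hk ha.ne' hφ
  have hIA : Integrable (A.indicator
      (fun _ : Fin k → S => Real.exp (t * (∑ i, l i * v i + δ * ∑ i, |l i|)))) ν :=
    (integrable_const _).indicator hAm
  have hIs : ∀ i, Integrable (fun y : Fin k → S =>
      (Real.exp (t * deviation x a (fun s => u s + η * f i s) y) *
          Real.exp (-(t * (η * (v i + δ)))) +
        Real.exp (t * deviation x a (fun s => u s + -η * f i s) y) *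
          Real.exp (t * (η * (v i - δ))))) ν := fun i =>
    ((hi1 _ (hup i)).mul_const _).add ((hi1 _ (hdn i)).mul_const _)
  have key := integral_mono (hi1 u hum) (hIA.add (integrable_finsetSum _ fun i _ => hIs i)) hpt
  rw [hi2 u hum] at key
  refine key.trans (le_of_eq ?_)
  simp only [Pi.add_apply]
  rw [integral_add hIA (integrable_finsetSum _ fun i _ => hIs i), integral_indicator_const _ hAm,
    smul_eq_mul, mul_comm, integral_finsetSum _ fun i _ => hIs i]
  congr 1
  refine Finset.sum_congr rfl fun i _ => ?_
  rw [integral_add ((hi1 _ (hup i)).mul_const _) ((hi1 _ (hdn i)).mul_const _),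
    integral_mul_const, integral_mul_const, hi2 _ (hup i), hi2 _ (hdn i)]

/-- The error term is at most half of the left side of `hprob`, because its exponent is lower by `2
* ε * t`. The remaining factor `1 / 2` is paid by the slack between `b` and `R + (b - R) / 2 + ε`.
-/
theorem exp_neg_le_of_exp_le_add {t R b ε M p : ℝ} (ht0 : 0 ≤ t) (hM0 : 0 ≤ M)
    (hε0 : 0 ≤ ε) (hεb : 8 * ε ≤ b - R) (hlt : Real.exp (-(ε * t)) < 1 / (4 * (M + 1)))
    (hprob : Real.exp (t * (R - ε)) ≤ Real.exp (t * (2 * R + (b - R) / 2)) * p +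
      M * (2 * Real.exp (t * (R - 3 * ε)))) :
    Real.exp (-(t * b)) ≤ p := by
  have e1 : Real.exp (t * (R - 3 * ε)) =
      Real.exp (t * (R - ε)) * Real.exp (-(ε * t)) * Real.exp (-(ε * t)) := by
    rw [← Real.exp_add, ← Real.exp_add]; congr 1; ring
  have e2 : Real.exp (t * (R - ε)) =
      Real.exp (t * (2 * R + (b - R) / 2)) * Real.exp (-(t * (R + (b - R) / 2 + ε))) := by
    rw [← Real.exp_add]; congr 1; ring
  have e3 : Real.exp (-(t * b)) ≤ Real.exp (-(t * (R + (b - R) / 2 + ε))) * Real.exp (-(ε * t)) := by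
    rw [← Real.exp_add]
    gcongr
    nlinarith [mul_nonneg ht0 hε0, mul_nonneg ht0 (sub_nonneg.2 hεb)]
  set q := Real.exp (-(ε * t)) with hq
  have hq0 : 0 < q := Real.exp_pos _
  have hqM : q * (4 * (M + 1)) < 1 := by rwa [lt_div_iff₀ (by positivity)] at hlt
  have hq1 : q ≤ 1 / 4 := by nlinarith
  have hhalf : Real.exp (t * (R - ε)) * (1 / 2) ≤ Real.exp (t * (2 * R + (b - R) / 2)) * p := by
    rw [e1] at hprob
    have h4 : M * 2 * (q * q) ≤ 1 / 2 := by nlinarith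
    nlinarith [Real.exp_pos (t * (R - ε))]
  rw [e2, mul_assoc] at hhalf
  have hfin := le_of_mul_le_mul_left hhalf (Real.exp_pos _)
  refine e3.trans (le_trans ?_ hfin)
  gcongr
  linarith

theorem variance_add_mul {P : Measure S} [IsProbabilityMeasure P] {u f : S → ℝ} (hu : MemLp u 2 P)
    (hf : MemLp f 2 P) (η : ℝ) :
    Var[fun s => u s + η * f s; P] = Var[u; P] + 2 * η * cov[u, f; P] + η ^ 2 * Var[f; P] := by
  rw [variance_fun_add hu (hf.const_mul η), covariance_const_mul_right, variance_const_mul]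
  ring

variable {Υ : Type*} [MeasurableSpace Υ] {μ : Measure Υ} {P : Measure S} {X : ℕ → Υ → S}

theorem eventually_exp_le_prob_deviation [IsProbabilityMeasure P]
    {a : ℕ → ℝ} (hapos : ∀ n, 1 ≤ n → 0 < a n) {k : ℕ → ℕ} (hk_top : Tendsto k atTop atTop)
    (hka : Tendsto (fun n => (k n : ℝ) * a n ^ 2) atTop atTop)
    {f : ι → S → ℝ} (hf : ∀ i, IsAdmissible μ X P a (f i)) {l v : ι → ℝ}
    (hcov : ∀ j, cov[fun s => ∑ i, l i * f i s, f j; P] = v j) {b : ℝ}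
    (hb : Var[fun s => ∑ i, l i * f i s; P] / 2 < b) {δ₀ : ℝ} (hδ₀ : 0 < δ₀) :
    ∃ F : Finset (S → ℝ), (∀ φ ∈ F, IsAdmissible μ X P a φ) ∧
      ∃ ε > 0, ∀ᶠ n in atTop, ∀ x : Fin n → S,
        (∀ φ ∈ F, |logMgf x (a n) φ - Var[φ; P] / 2| < ε) →
        Real.exp (-(k n * a n ^ 2 * b)) ≤ (Measure.pi fun _ : Fin (k n) => empirical x).real
          {y | ∀ i, |deviation x (a n) (f i) y - v i| < δ₀} := by
  classical
  set u : S → ℝ := fun s => ∑ i, l i * f i s with hu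
  have hua : IsAdmissible μ X P a u := IsAdmissible.sum_mul hapos _ l fun i _ => hf i
  set R := Var[u; P] / 2 with hR
  have hR2 : ∑ i, l i * v i = 2 * R := by
    rw [hR, ← covariance_self hua.measurable.aemeasurable]
    conv_rhs => rw [hu]
    rw [covariance_fun_sum_left (fun i => (hf i).memLp.const_mul _) hua.memLp]
    simp_rw [covariance_const_mul_left, covariance_comm (f _) u, hcov]
    ring
  obtain ⟨W, hW0, hW⟩ : ∃ W > 0, ∀ i, Var[f i; P] ≤ W := by
    refine ⟨∑ i, Var[f i; P] + 1, ?_, fun i => ?_⟩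
    · have := Finset.sum_nonneg fun i (_ : i ∈ Finset.univ) => variance_nonneg (f i) P
      linarith
    · have := Finset.single_le_sum (fun i (_ : i ∈ Finset.univ) => variance_nonneg (f i) P)
        (Finset.mem_univ i)
      linarith
  have hL0 : 0 ≤ ∑ i, |l i| := Finset.sum_nonneg fun i _ => abs_nonneg _
  set L := ∑ i, |l i| with hL
  set δ := min δ₀ ((b - R) / (2 * (L + 1))) with hδdef
  have hbR : 0 < b - R := by linarith
  have hδ : 0 < δ := by positivity
  have hδL : δ * L ≤ (b - R) / 2 := by
    calc δ * L ≤ (b - R) / (2 * (L + 1)) * (L + 1) := by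
          gcongr
          · exact min_le_right _ _
          · linarith
      _ = (b - R) / 2 := by field_simp
  -- The quadratic cost `η ^ 2 * Var[f i; P] / 2` of the extra tilt is then at most half of its gain
  -- `η * δ`.
  set η := δ / W with hη
  have hη0 : 0 < η := by positivity
  -- The first entry turns the exit exponent `R - η * δ / 2 + ε` into at most `R - 3 * ε`; the
  -- second provides the slack of `exp_neg_le_of_exp_le_add`.
  set ε := min (η * δ / 8) ((b - R) / 8) with hε
  have hε0 : 0 < ε := by positivity
  refine ⟨insert u (Finset.univ.image (fun i s => u s + η * f i s) ∪
    Finset.univ.image (fun i s => u s + -η * f i s)), ?_, ε, hε0, ?_⟩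
  · intro φ hφ
    simp only [Finset.mem_insert, Finset.mem_union, Finset.mem_image, Finset.mem_univ,
      true_and] at hφ
    rcases hφ with rfl | ⟨i, rfl⟩ | ⟨i, rfl⟩
    · exact hua
    · exact hua.add hapos ((hf i).const_mul η)
    · exact hua.add hapos ((hf i).const_mul (-η))
  have hlim : Tendsto (fun n => Real.exp (-(ε * (k n * a n ^ 2)))) atTop (𝓝 0) :=
    Real.tendsto_exp_neg_atTop_nhds_zero.comp (hka.const_mul_atTop hε0)
  obtain ⟨M, hM⟩ : ∃ M : ℝ, M = Fintype.card ι := ⟨_, rfl⟩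
  have hM0 : 0 ≤ M := by rw [hM]; positivity
  filter_upwards [eventually_ge_atTop 1, hk_top.eventually_ge_atTop 1,
    hlim.eventually (gt_mem_nhds (show (0 : ℝ) < 1 / (4 * (M + 1)) by positivity))]
    with n hn hk hlt x hx
  have hxu := hx u (by simp)
  have hxp : ∀ i, |logMgf x (a n) (fun s => u s + η * f i s) -
      Var[fun s => u s + η * f i s; P] / 2| < ε := fun i => hx _ (by simp)
  have hxm : ∀ i, |logMgf x (a n) (fun s => u s + -η * f i s) -
      Var[fun s => u s + -η * f i s; P] / 2| < ε := fun i => hx _ (by simp)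
  have hmain := exp_logMgf_le_prob_add (by lia) (by lia) x (hapos n hn)
    (fun i => (hf i).measurable) l v (δ := δ) hη0.le (k := k n)
  set t : ℝ := k n * a n ^ 2 with ht
  have ht0 : 0 ≤ t := by positivity
  set p := (Measure.pi fun _ : Fin (k n) => empirical x).real
    {y | ∀ i, |deviation x (a n) (f i) y - v i| < δ} with hp
  have hpp : p ≤ (Measure.pi fun _ : Fin (k n) => empirical x).real
      {y | ∀ i, |deviation x (a n) (f i) y - v i| < δ₀} :=
    measureReal_mono fun y hy i => (hy i).trans_le (min_le_left _ _)
  refine le_trans ?_ hpp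
  have hηW : ∀ i, η ^ 2 * Var[f i; P] ≤ η * δ := fun i => by
    calc η ^ 2 * Var[f i; P] ≤ η ^ 2 * W := by gcongr; exact hW i
      _ = η * δ := by rw [hη]; field_simp
  have hεη : 8 * ε ≤ η * δ := by
    have := min_le_left (η * δ / 8) ((b - R) / 8)
    linarith
  have hεb : 8 * ε ≤ b - R := by
    have := min_le_right (η * δ / 8) ((b - R) / 8)
    linarith
  have hterm : ∀ i ∈ Finset.univ,
      (Real.exp (t * (logMgf x (a n) fun s => (∑ i, l i * f i s) + η * f i s)) *
          Real.exp (-(t * (η * (v i + δ)))) +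
        Real.exp (t * (logMgf x (a n) fun s => (∑ i, l i * f i s) + -η * f i s)) *
          Real.exp (t * (η * (v i - δ)))) ≤ 2 * Real.exp (t * (R - 3 * ε)) := by
    intro i _
    have h1 := (abs_lt.1 (hxp i)).2
    have h2 := (abs_lt.1 (hxm i)).2
    rw [variance_add_mul hua.memLp (hf i).memLp, hcov i] at h1 h2
    have h3 := hηW i
    rw [two_mul, ← Real.exp_add, ← Real.exp_add]
    refine add_le_add (Real.exp_le_exp.2 ?_) (Real.exp_le_exp.2 ?_)
    · rw [← mul_neg, ← mul_add]
      refine mul_le_mul_of_nonneg_left ?_ ht0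
      change logMgf x (a n) (fun s => u s + η * f i s) + _ ≤ _
      nlinarith
    · rw [← mul_add]
      refine mul_le_mul_of_nonneg_left ?_ ht0
      change logMgf x (a n) (fun s => u s + -η * f i s) + _ ≤ _
      nlinarith
  have hsum := Finset.sum_le_sum hterm
  rw [Finset.sum_const, Finset.card_univ, nsmul_eq_mul, ← hM] at hsum
  have hlow : Real.exp (t * (R - ε)) ≤ Real.exp (t * logMgf x (a n) u) := by
    have := (abs_lt.1 hxu).1
    gcongr
    linarith
  have hprob : Real.exp (t * (R - ε)) ≤ Real.exp (t * (2 * R + (b - R) / 2)) * p +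
      M * (2 * Real.exp (t * (R - 3 * ε))) := by
    refine hlow.trans (hmain.trans (add_le_add ?_ hsum))
    rw [hR2]
    gcongr
  exact exp_neg_le_of_exp_le_add ht0 hM0 hε0.le hεb hlt hprob

end LowerBound

/-! ### Inner probabilities and the lower bound in `τ_Θ` -/

open scoped Uniformity in
theorem exists_finset_of_mem_uniformity_pi {ι : Type*} {V : Set ((ι → ℝ) × (ι → ℝ))}
    (hV : V ∈ 𝓤 (ι → ℝ)) :
    ∃ I : Finset ι, ∃ δ > 0, ∀ v w : ι → ℝ, (∀ i ∈ I, |w i - v i| < δ) → (v, w) ∈ V := by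
  rw [Pi.uniformity, Filter.mem_iInf] at hV
  obtain ⟨I, hI, W, hW, rfl⟩ := hV
  have hδ : ∀ i : I, ∃ δ > 0, ∀ v w : ι → ℝ, |w i - v i| < δ → (v, w) ∈ W i := by
    intro i
    obtain ⟨t, ht, hsub⟩ := hW i
    obtain ⟨δ, hδ, h⟩ := Metric.mem_uniformity_dist.1 ht
    refine ⟨δ, hδ, fun v w hvw => hsub (h ?_)⟩
    rwa [dist_comm, Real.dist_eq]
  choose δ hδ hδW using hδ
  have := hI.fintype
  obtain ⟨ε, hε, hle⟩ : ∃ ε > 0, ∀ i, ε ≤ δ i := by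
    rcases isEmpty_or_nonempty I with h | h
    · exact ⟨1, one_pos, fun i => h.elim i⟩
    · obtain ⟨i, hi⟩ := Finite.exists_min δ
      exact ⟨δ i, hδ i, hi⟩
  refine ⟨hI.toFinset, ε, hε, fun v w h => Set.mem_iInter.2 fun i => hδW i v w ?_⟩
  exact (h i (by simp)).trans_le (hle i)

theorem log_ofReal_exp (y : ℝ) : ENNReal.log (ENNReal.ofReal (Real.exp y)) = y := by
  rw [ENNReal.log_ofReal_of_pos (Real.exp_pos _), Real.log_exp]

theorem le_inv_mul_log {t b : ℝ} (ht : 0 < t) {p : ℝ≥0∞}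
    (h : ENNReal.ofReal (Real.exp (t * b)) ≤ p) :
    (b : EReal) ≤ ((t⁻¹ : ℝ) : EReal) * ENNReal.log p := by
  have h1 := mul_le_mul_of_nonneg_left (ENNReal.log_le_log h)
    (EReal.coe_nonneg.2 (inv_nonneg.2 ht.le))
  rwa [log_ofReal_exp, ← EReal.coe_mul, inv_mul_cancel_left₀ ht.ne'] at h1

theorem inv_mul_log_le {t b : ℝ} (ht : 0 < t) {p : ℝ≥0∞}
    (h : p ≤ ENNReal.ofReal (Real.exp (t * b))) :
    ((t⁻¹ : ℝ) : EReal) * ENNReal.log p ≤ (b : EReal) := by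
  have h1 := mul_le_mul_of_nonneg_left (ENNReal.log_le_log h)
    (EReal.coe_nonneg.2 (inv_nonneg.2 ht.le))
  rwa [log_ofReal_exp, ← EReal.coe_mul, inv_mul_cancel_left₀ ht.ne'] at h1

theorem prob_le_bootstrapInner {Θ : Set (S → ℝ)} (hΘ : ∀ f ∈ Θ, Measurable f) {n k : ℕ}
    (hn : n ≠ 0) (hk : k ≠ 0) (x : Fin n → S) {a : ℝ} (ha : a ≠ 0)
    {Ω₀ U : Set (ZeroMassMeasure Θ)} (hU : MeasurableSet U) (hUΩ : U ⊆ Ω₀)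
    (hm : MeasurableSet {y : Fin k → S | deviationMeasure hΘ hn hk x a y ∈ U}) :
    (Measure.pi fun _ : Fin k => empirical x) {y | deviationMeasure hΘ hn hk x a y ∈ U} ≤
      bootstrapInner x k a Ω₀ := by
  have := isProbabilityMeasure_empirical hn x
  have h1 : bootstrapOuter x k a Ω₀ᶜ ≤ (Measure.pi fun _ : Fin k => empirical x)
      {y : Fin k → S | deviationMeasure hΘ hn hk x a y ∈ U}ᶜ := by
    refine (iInf_le_of_le Uᶜ (iInf_le_of_le (Set.compl_subset_compl.2 hUΩ)
      (iInf_le_of_le hU.compl ?_)))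
    rw [bootstrapEvent_eq hΘ hn hk x ha]
    rfl
  rw [prob_compl_eq_one_sub hm] at h1
  calc _ = 1 - (1 - (Measure.pi fun _ : Fin k => empirical x)
        {y : Fin k → S | deviationMeasure hΘ hn hk x a y ∈ U}) :=
      (ENNReal.sub_sub_cancel ENNReal.one_ne_top prob_le_one).symm
    _ ≤ _ := tsub_le_tsub_left h1 1

theorem bootstrapOuter_le_prob {Θ : Set (S → ℝ)} (hΘ : ∀ f ∈ Θ, Measurable f) {n k : ℕ}
    (hn : n ≠ 0) (hk : k ≠ 0) (x : Fin n → S) {a : ℝ} (ha : a ≠ 0)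
    {Ω₀ A : Set (ZeroMassMeasure Θ)} (hA : MeasurableSet A) (hΩA : Ω₀ ⊆ A) :
    bootstrapOuter x k a Ω₀ ≤
      (Measure.pi fun _ : Fin k => empirical x) {y | deviationMeasure hΘ hn hk x a y ∈ A} := by
  refine iInf_le_of_le A (iInf_le_of_le hΩA (iInf_le_of_le hA ?_))
  rw [bootstrapEvent_eq hΘ hn hk x ha]

section Lower

variable {Υ : Type*} [MeasurableSpace Υ] {μ : Measure Υ} {P : Measure S} [IsProbabilityMeasure P]
  {X : ℕ → Υ → S}

theorem liminfGe_bootstrapInner (hX : ∀ i, Measurable (X i)) (hindep : iIndepFun X μ)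
    (hlaw : ∀ i, μ.map (X i) = P) {a : ℕ → ℝ} (ha : Tendsto a atTop (𝓝 0))
    (hapos : ∀ n, 1 ≤ n → 0 < a n) {k : ℕ → ℕ} (hk_top : Tendsto k atTop atTop)
    (hka : Tendsto (fun n => (k n : ℝ) * a n ^ 2) atTop atTop)
    {Θ : Set (S → ℝ)} (hΘ : ∀ f ∈ Θ, IsAdmissible μ X P a f) (Ω₀ : Set (ZeroMassMeasure Θ)) :
    LiminfGeInnerAS μ
      (fun n ω => (((k n * a n ^ 2)⁻¹ : ℝ) : EReal) *
        ENNReal.log (bootstrapInner (sample X n ω) (k n) (a n) Ω₀))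
      (-(rateSet P (interior Ω₀) : EReal)) := by
  have hΘm : ∀ f ∈ Θ, Measurable f := fun f hf => (hΘ f hf).measurable
  have hΘL : ∀ f ∈ Θ, MemLp f 2 P := fun f hf => (hΘ f hf).memLp
  refine liminfGeInnerAS_of_logMgf hX hindep hlaw ha hapos fun r hr => ?_
  have hr' : (rateSet P (interior Ω₀) : EReal) < ((-r : ℝ) : EReal) := by
    rw [EReal.coe_neg]
    exact EReal.lt_neg_comm.1 hr
  have hrpos : 0 < -r := by
    have : (0 : EReal) < ((-r : ℝ) : EReal) := (EReal.coe_ennreal_nonneg _).trans_lt hr'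
    exact_mod_cast this
  have hrate : rateSet P (interior Ω₀) < ENNReal.ofReal (-r) := by
    rw [← EReal.coe_ennreal_lt_coe_ennreal_iff, EReal.coe_ennreal_ofReal, max_eq_left hrpos.le]
    exact hr'
  simp only [rateSet, iInf_lt_iff] at hrate
  obtain ⟨G, hG, hGr⟩ := hrate
  obtain ⟨g, -, hg, hg0, hgG, hgr⟩ := exists_density_of_rate_ne_top hΘm hΘL
    (hGr.trans ENNReal.ofReal_lt_top).ne
  rw [hgr, ENNReal.ofReal_lt_ofReal_iff hrpos] at hGr
  -- The induced topology yields a box in finitely many coordinates around `G` that stays inside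
  -- `Ω₀`; such a box is also `σ_Θ`-measurable.
  obtain ⟨V, hV, hVΩ⟩ := (mem_nhds_induced _ _ _).1 (mem_interior_iff_mem_nhds.1 hG)
  obtain ⟨V', hV', hball⟩ := UniformSpace.mem_nhds_iff.1 hV
  obtain ⟨I, δ, hδ, hI⟩ := exists_finset_of_mem_uniformity_pi hV'
  obtain ⟨l, hcov, hvar⟩ := exists_combination_cov_eq (f := fun i : I => ((i : Θ) : S → ℝ))
    (fun i => hΘL _ i.1.2) hg hg0
  obtain ⟨F, hF, ε, hε, hev⟩ := eventually_exp_le_prob_deviation hapos hk_top hka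
    (f := fun i : I => ((i : Θ) : S → ℝ)) (fun i => hΘ _ i.1.2) hcov (b := -r) (by linarith) hδ
  refine ⟨F, hF, ε, hε, ?_⟩
  filter_upwards [hev, eventually_ge_atTop 1, hk_top.eventually_ge_atTop 1,
    hka.eventually_gt_atTop 0] with n hn hn1 hk1 ht ω hω
  have hp := hn _ hω
  refine le_inv_mul_log ht ?_
  have hn0 : n ≠ 0 := by lia
  have hk0 : k n ≠ 0 := by lia
  set U : Set (ZeroMassMeasure Θ) := {H | ∀ i : I, |evalMap Θ H i - evalMap Θ G i| < δ} with hU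
  have hUm : MeasurableSet U := by
    have : U = ⋂ i : I, {H | evalMap Θ H i ∈ {z | |z - evalMap Θ G i| < δ}} := by
      ext; simp [hU]
    rw [this]
    exact MeasurableSet.iInter fun i => measurableSet_evalMap_preimage _
      (measurableSet_lt (by fun_prop) measurable_const)
  have hUΩ : U ⊆ Ω₀ := fun H hH => hVΩ (hball (hI _ _ fun i hi => hH ⟨i, hi⟩))
  have hUset : {y | deviationMeasure hΘm hn0 hk0 (sample X n ω) (a n) y ∈ U} =
      {y : Fin (k n) → S | ∀ i : I, |deviation (sample X n ω) (a n) ((i : Θ) : S → ℝ) y -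
        ∫ s, ((i : Θ) : S → ℝ) s * g s ∂P| < δ} := by
    ext y
    simp only [hU, Set.mem_ofPred_eq, evalMap_deviationMeasure, hgG]
  have hmeas : MeasurableSet {y | deviationMeasure hΘm hn0 hk0 (sample X n ω) (a n) y ∈ U} := by
    have e : {y | deviationMeasure hΘm hn0 hk0 (sample X n ω) (a n) y ∈ U} = ⋂ i : I,
        {y : Fin (k n) → S | |deviation (sample X n ω) (a n) ((i : Θ) : S → ℝ) y -
          ∫ s, ((i : Θ) : S → ℝ) s * g s ∂P| < δ} := by
      rw [hUset]; ext; simp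
    rw [e]
    refine MeasurableSet.iInter fun i => ?_
    have := measurable_deviation (k := k n) (sample X n ω) (a n) (hΘm _ i.1.2)
    exact measurableSet_lt (by fun_prop) measurable_const
  refine le_trans ?_ (prob_le_bootstrapInner hΘm hn0 hk0 _ (hapos n hn1).ne' hUm hUΩ hmeas)
  rw [hUset]
  have := isProbabilityMeasure_empirical hn0 (sample X n ω)
  rw [← ofReal_measureReal]
  refine ENNReal.ofReal_le_ofReal ?_
  rw [← mul_neg, neg_neg] at hp
  exact hp

end Lower

/-! ### Compact level sets and separating half-spaces -/

theorem inner_toLp_toLp {P : Measure S} {f g : S → ℝ} (hf : MemLp f 2 P) (hg : MemLp g 2 P) :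
    inner ℝ (hg.toLp g) (hf.toLp f) = ∫ s, f s * g s ∂P := by
  rw [L2.inner_def]
  refine integral_congr_ae ?_
  filter_upwards [hg.coeFn_toLp, hf.coeFn_toLp] with s h1 h2
  rw [h1, h2]
  simp

/-- Square integrable densities of mean zero with rate at most `c`. -/
structure IsDensity (P : Measure S) (c : ℝ) (g : S → ℝ) : Prop where
  measurable : Measurable g
  memLp : MemLp g 2 P
  integral_eq_zero : ∫ s, g s ∂P = 0
  integral_sq_le : ∫ s, g s ^ 2 ∂P ≤ 2 * c

/-- By Riesz, densities are functionals on `L²`; the norm bound gives a weak-* compact ball by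
Banach-Alaoglu, and mean zero is the closed condition of annihilating the constant `1`. Evaluation
at the `f i` is weak-* continuous. The index type may be infinite, which permits `ι = Θ`. -/
theorem isCompact_setOf_pairing {P : Measure S} [IsProbabilityMeasure P] {ι : Type*}
    {f : ι → S → ℝ} (hf : ∀ i, MemLp (f i) 2 P) {c : ℝ} (hc : 0 ≤ c) :
    IsCompact {v : ι → ℝ | ∃ g, IsDensity P c g ∧ ∀ i, v i = ∫ s, f i s * g s ∂P} := by
  set one : Lp ℝ 2 P := (memLp_const (1 : ℝ)).toLp (fun _ => (1 : ℝ)) with hone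
  set D : Set (WeakDual ℝ (Lp ℝ 2 P)) :=
    WeakDual.toStrongDual ⁻¹' Metric.closedBall 0 (√(2 * c)) ∩ {ℓ | ℓ one = 0} with hD
  have hDc : IsCompact D := (WeakDual.isCompact_closedBall 0 _).inter_right
    (isClosed_eq (WeakDual.eval_continuous one) continuous_const)
  have himg := hDc.image (f := fun ℓ : WeakDual ℝ (Lp ℝ 2 P) => fun i => ℓ ((hf i).toLp (f i)))
    (continuous_pi fun i => WeakDual.eval_continuous _)
  convert himg using 1
  ext v
  constructor
  · rintro ⟨g, hg, hv⟩
    refine ⟨StrongDual.toWeakDual (InnerProductSpace.toDual ℝ _ (hg.memLp.toLp g)),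
      ⟨?_, ?_⟩, ?_⟩
    · simp only [Set.mem_preimage, mem_closedBall_zero_iff]
      change ‖InnerProductSpace.toDual ℝ _ (hg.memLp.toLp g)‖ ≤ _
      rw [LinearIsometryEquiv.norm_map]
      refine Real.le_sqrt_of_sq_le ?_
      rw [norm_toLp_sq]
      exact hg.integral_sq_le
    · change inner ℝ (hg.memLp.toLp g) one = 0
      rw [hone, inner_toLp_toLp]
      simpa using hg.integral_eq_zero
    · funext i
      change inner ℝ (hg.memLp.toLp g) ((hf i).toLp (f i)) = v i
      rw [inner_toLp_toLp, hv]
  · rintro ⟨ℓ, ⟨h1, h2⟩, rfl⟩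
    set G : Lp ℝ 2 P := (InnerProductSpace.toDual ℝ _).symm (WeakDual.toStrongDual ℓ) with hG
    have hℓ : ∀ w, ℓ w = inner ℝ G w := fun w => by
      rw [hG, InnerProductSpace.toDual_symm_apply]; rfl
    have hGLp := Lp.memLp G
    have hGe : hGLp.toLp G = G := Lp.toLp_coeFn G hGLp
    refine ⟨G, ⟨(Lp.stronglyMeasurable G).measurable, hGLp, ?_, ?_⟩, fun i => ?_⟩
    · have : ℓ one = 0 := h2
      rw [hℓ, ← hGe, hone, inner_toLp_toLp] at this
      simpa using this
    · rw [← norm_toLp_sq hGLp, hGe, hG, LinearIsometryEquiv.norm_map]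
      simp only [Set.mem_preimage, mem_closedBall_zero_iff] at h1
      calc ‖WeakDual.toStrongDual ℓ‖ ^ 2 ≤ √(2 * c) ^ 2 := by gcongr
        _ = 2 * c := Real.sq_sqrt (by positivity)
    · rw [← inner_toLp_toLp (hf i) hGLp, hGe]
      exact hℓ _

theorem prob_le_exp_logMgf {n k : ℕ} (hn : n ≠ 0) (hk : k ≠ 0) (x : Fin n → S) {a : ℝ}
    (ha : 0 < a) {φ : S → ℝ} (hφ : Measurable φ) (r : ℝ) {η : ℝ} (hη : 0 ≤ η) :
    (Measure.pi fun _ : Fin k => empirical x).real {y | r ≤ deviation x a φ y} ≤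
      Real.exp (k * a ^ 2 * ((logMgf x a fun s => η * φ s) - η * r)) := by
  have := isProbabilityMeasure_empirical hn x
  have hm : Measurable (fun s => η * φ s) := by fun_prop
  have hmeas : MeasurableSet {y : Fin k → S | r ≤ deviation x a φ y} :=
    measurableSet_le measurable_const (measurable_deviation x a hφ)
  have h := integral_mono (μ := Measure.pi fun _ : Fin k => empirical x)
    (f := {y : Fin k → S | r ≤ deviation x a φ y}.indicator
      fun _ => Real.exp (k * a ^ 2 * (η * r)))
    (g := fun y => Real.exp (k * a ^ 2 * deviation x a (fun s => η * φ s) y))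
    ((integrable_const _).indicator hmeas)
    (integrable_exp_deviation x hk ha.ne' hm) (fun y => by
      refine Set.indicator_apply_le' (fun hy => ?_) (fun _ => (Real.exp_pos _).le)
      simp only [deviation_const_mul]
      gcongr
      exact hy)
  rw [integral_indicator_const _ hmeas, integral_exp_deviation x hn hk ha.ne' hm, smul_eq_mul] at h
  rw [mul_sub, Real.exp_sub, le_div_iff₀ (Real.exp_pos _)]
  exact h

section HalfSpaces

variable {P : Measure S} [IsProbabilityMeasure P] {ι : Type*} [Fintype ι]

/-- Hahn-Banach separates `w` from the convex compact set of pairings. The separating level `r`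
exceeds the support function in direction `l`, which is at least `√(2 * c * Var)`, as the suitably
scaled centred combination `∑ l i * f i` shows. -/
theorem exists_halfSpace {f : ι → S → ℝ} (hfm : ∀ i, Measurable (f i))
    (hf : ∀ i, MemLp (f i) 2 P) {c : ℝ} (hc : 0 ≤ c) {w : ι → ℝ} {ε : ℝ} (hε : 0 < ε)
    (hw : ∀ g, IsDensity P c g → ∃ i, ε ≤ |w i - ∫ s, f i s * g s ∂P|) :
    ∃ (l : ι → ℝ) (r : ℝ), 0 < r ∧ 2 * c * Var[fun s => ∑ i, l i * f i s; P] ≤ r ^ 2 ∧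
      r < ∑ i, l i * w i := by
  classical
  set C : Set (ι → ℝ) := {v | ∃ g, IsDensity P c g ∧ ∀ i, v i = ∫ s, f i s * g s ∂P} with hC
  have hconv : Convex ℝ C := by
    rintro v ⟨g, hg, hv⟩ v' ⟨g', hg', hv'⟩ α β hα hβ hαβ
    have h1 := hg.memLp.const_mul α
    have h2 := hg'.memLp.const_mul β
    refine ⟨fun s => α * g s + β * g' s, ⟨?_, h1.add h2, ?_, ?_⟩, fun i => ?_⟩
    · exact (hg.measurable.const_mul α).add (hg'.measurable.const_mul β)
    · rw [integral_add (h1.integrable (by norm_num)) (h2.integrable (by norm_num)),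
        integral_const_mul, integral_const_mul, hg.integral_eq_zero, hg'.integral_eq_zero]
      simp
    · calc ∫ s, (α * g s + β * g' s) ^ 2 ∂P ≤ ∫ s, (α * g s ^ 2 + β * g' s ^ 2) ∂P := by
            refine integral_mono (h1.add h2).integrable_sq
              ((hg.memLp.integrable_sq.const_mul α).add (hg'.memLp.integrable_sq.const_mul β))
              fun s => ?_
            have hβ' : β = 1 - α := by linarith
            subst hβ'
            simp only
            nlinarith [mul_nonneg (mul_nonneg hα hβ) (sq_nonneg (g s - g' s))]
        _ = α * ∫ s, g s ^ 2 ∂P + β * ∫ s, g' s ^ 2 ∂P := by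
            rw [integral_add (hg.memLp.integrable_sq.const_mul α)
              (hg'.memLp.integrable_sq.const_mul β), integral_const_mul, integral_const_mul]
        _ ≤ α * (2 * c) + β * (2 * c) := by
            gcongr
            · exact hg.integral_sq_le
            · exact hg'.integral_sq_le
        _ = 2 * c := by rw [← add_mul, hαβ, one_mul]
    · have i1 : Integrable (fun s => f i s * g s) P := (hf i).integrable_mul hg.memLp
      have i2 : Integrable (fun s => f i s * g' s) P := (hf i).integrable_mul hg'.memLp
      simp only [Pi.add_apply, Pi.smul_apply, smul_eq_mul, hv, hv']
      rw [← integral_const_mul, ← integral_const_mul,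
        ← integral_add (i1.const_mul α) (i2.const_mul β)]
      exact integral_congr_ae (ae_of_all _ fun s => by simp only; ring)
  have hnot : w ∉ C := by
    rintro ⟨g, hg, hv⟩
    obtain ⟨i, hi⟩ := hw g hg
    rw [hv i, sub_self, abs_zero] at hi
    linarith
  obtain ⟨L, r, hLC, hLw⟩ := geometric_hahn_banach_closed_point hconv
    (isCompact_setOf_pairing hf hc).isClosed hnot
  set l : ι → ℝ := fun i => L fun j => if i = j then 1 else 0 with hl
  have hL : ∀ v, L v = ∑ i, l i * v i := fun v => by
    have := LinearMap.pi_apply_eq_sum_univ (L : (ι → ℝ) →ₗ[ℝ] ℝ) v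
    simpa [hl, mul_comm] using this
  -- The zero density has rate `0`, so the origin belongs to `C`.
  have hr0 : 0 < r := by
    have := hLC 0 ⟨fun _ => 0, ⟨measurable_const, by simp, by simp, by simpa using hc⟩,
      fun i => by simp⟩
    simpa using this
  refine ⟨l, r, hr0, ?_, by rw [← hL]; exact hLw⟩
  set φ : S → ℝ := fun s => ∑ i, l i * f i s with hφ
  have hφm : Measurable φ := by fun_prop
  have hφL : MemLp φ 2 P := memLp_finsetSum _ fun i _ => (hf i).const_mul _
  rcases (variance_nonneg φ P).eq_or_lt with hV | hV
  · rw [← hV]; simp [sq_nonneg]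
  set V := Var[φ; P] with hVdef
  -- This scaling puts the centred `φ` on the sphere `∫ g² = 2 * c`.
  set β := √(2 * c / V) with hβ
  have hβ2 : β ^ 2 * V = 2 * c := by
    rw [hβ, Real.sq_sqrt (by positivity)]
    field_simp
  have hcen : MemLp (fun s => φ s - ∫ s, φ s ∂P) 2 P := hφL.sub (memLp_const _)
  have hVint : ∫ s, (φ s - ∫ s, φ s ∂P) ^ 2 ∂P = V := by
    rw [hVdef, variance_eq_integral hφm.aemeasurable]
  have hcen0 : ∫ s, (φ s - ∫ s, φ s ∂P) ∂P = 0 := by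
    rw [integral_sub (hφL.integrable (by norm_num)) (integrable_const _)]
    simp
  have hgd : IsDensity P c (fun s => β * (φ s - ∫ s, φ s ∂P)) := by
    refine ⟨by fun_prop, hcen.const_mul β, ?_, ?_⟩
    · rw [integral_const_mul, hcen0, mul_zero]
    · simp_rw [mul_pow]
      rw [integral_const_mul, hVint, hβ2]
  have hval := hLC _ ⟨_, hgd, fun i => rfl⟩
  rw [hL] at hval
  have hfg : ∀ i, Integrable (fun s => f i s * (β * (φ s - ∫ s, φ s ∂P))) P :=
    fun i => (hf i).integrable_mul hgd.memLp
  have hcomp : ∑ i, l i * ∫ s, f i s * (β * (φ s - ∫ s, φ s ∂P)) ∂P = β * V := by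
    simp_rw [← integral_const_mul]
    rw [← integral_finsetSum _ fun i _ => (hfg i).const_mul _]
    have : ∀ s, ∑ i, l i * (f i s * (β * (φ s - ∫ s, φ s ∂P))) =
        β * (φ s - ∫ s, φ s ∂P) ^ 2 + (β * ∫ s, φ s ∂P) * (φ s - ∫ s, φ s ∂P) := fun s => by
      simp_rw [← mul_assoc (l _)]
      rw [← Finset.sum_mul]
      change φ s * _ = _
      ring
    simp_rw [this]
    rw [integral_add (hcen.integrable_sq.const_mul _)
      ((hcen.integrable (by norm_num)).const_mul _), integral_const_mul, integral_const_mul,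
      hVint, hcen0]
    ring
  rw [hcomp] at hval
  have hβV : 0 ≤ β * V := by positivity
  calc 2 * c * V = (β * V) ^ 2 := by rw [← hβ2]; ring
    _ ≤ r ^ 2 := by gcongr

/-- The far points form a closed set. Within the cube `[-R, R]^ι` compactness extracts a finite
subcover from the open half-spaces of `exists_halfSpace`; outside it the coordinate half-spaces `± w
i ≥ R` suffice. -/
theorem exists_finset_halfSpaces {f : ι → S → ℝ} (hfm : ∀ i, Measurable (f i))
    (hf : ∀ i, MemLp (f i) 2 P) {c : ℝ} (hc : 0 ≤ c) {ε : ℝ} (hε : 0 < ε) :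
    ∃ T : Finset ((ι → ℝ) × ℝ),
      (∀ p ∈ T, 0 < p.2 ∧ 2 * c * Var[fun s => ∑ i, p.1 i * f i s; P] ≤ p.2 ^ 2) ∧
      ∀ w : ι → ℝ, (∀ g, IsDensity P c g → ∃ i, ε ≤ |w i - ∫ s, f i s * g s ∂P|) →
        ∃ p ∈ T, p.2 ≤ ∑ i, p.1 i * w i := by
  classical
  obtain ⟨R, hR0, hR⟩ : ∃ R : ℝ, 0 < R ∧ ∀ i, 2 * c * Var[f i; P] ≤ R ^ 2 := by
    have h0 : ∀ i ∈ Finset.univ, 0 ≤ 2 * c * Var[f i; P] := fun i _ =>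
      mul_nonneg (by positivity) (variance_nonneg _ _)
    refine ⟨∑ i, 2 * c * Var[f i; P] + 1, ?_, fun i => ?_⟩
    · have := Finset.sum_nonneg h0
      linarith
    · have h1 := Finset.single_le_sum h0 (Finset.mem_univ i)
      have h2 := h0 i (Finset.mem_univ i)
      nlinarith
  set K : Set (ι → ℝ) := {w | ∀ g, IsDensity P c g → ∃ i, ε ≤ |w i - ∫ s, f i s * g s ∂P|} ∩
    Set.Icc (fun _ => -R) (fun _ => R) with hK
  have hclosed : IsClosed {w : ι → ℝ | ∀ g, IsDensity P c g →
      ∃ i, ε ≤ |w i - ∫ s, f i s * g s ∂P|} := by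
    have : {w : ι → ℝ | ∀ g, IsDensity P c g → ∃ i, ε ≤ |w i - ∫ s, f i s * g s ∂P|} =
        ⋂ g, ⋂ (_ : IsDensity P c g), ⋃ i, {w | ε ≤ |w i - ∫ s, f i s * g s ∂P|} := by
      ext; simp
    rw [this]
    refine isClosed_iInter fun g => isClosed_iInter fun _ => isClosed_iUnion_of_finite fun i => ?_
    exact isClosed_le continuous_const (by fun_prop)
  have hKc : IsCompact K := isCompact_Icc.inter_left hclosed
  obtain ⟨t, ht⟩ := hKc.elim_finite_subcover
    (fun q : {q : (ι → ℝ) × ℝ // 0 < q.2 ∧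
      2 * c * Var[fun s => ∑ i, q.1 i * f i s; P] ≤ q.2 ^ 2} =>
      {w : ι → ℝ | q.1.2 < ∑ i, q.1.1 i * w i})
    (fun q => isOpen_lt continuous_const (by fun_prop))
    (fun w hw => by
      obtain ⟨l, r, hr, hv, hlt⟩ := exists_halfSpace hfm hf hc hε hw.1
      exact Set.mem_iUnion.2 ⟨⟨(l, r), hr, hv⟩, hlt⟩)
  refine ⟨t.image Subtype.val ∪ (Finset.univ.image (fun i => (Pi.single i (1 : ℝ), R)) ∪
    Finset.univ.image (fun i => (Pi.single i (-1 : ℝ), R))), ?_, fun w hw => ?_⟩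
  · intro p hp
    simp only [Finset.mem_union, Finset.mem_image, Finset.mem_univ, true_and] at hp
    rcases hp with ⟨q, -, rfl⟩ | ⟨i, rfl⟩ | ⟨i, rfl⟩
    · exact q.2
    · refine ⟨hR0, ?_⟩
      simpa [Pi.single_apply] using hR i
    · refine ⟨hR0, ?_⟩
      have : Var[fun s => -f i s; P] = Var[f i; P] := variance_neg
      simpa [Pi.single_apply, this] using hR i
  · by_cases hin : w ∈ Set.Icc (fun _ : ι => -R) (fun _ => R)
    · obtain ⟨q, hq, hlt⟩ := Set.mem_iUnion₂.1 (ht ⟨hw, hin⟩)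
      exact ⟨q.1, Finset.mem_union_left _ (Finset.mem_image_of_mem _ hq), le_of_lt hlt⟩
    · have : ∃ i, w i < -R ∨ R < w i := by
        by_contra! h
        exact hin ⟨fun i => (h i).1, fun i => (h i).2⟩
      obtain ⟨i, hi | hi⟩ := this
      · refine ⟨(Pi.single i (-1 : ℝ), R), by simp, ?_⟩
        simp [Pi.single_apply]
        linarith
      · refine ⟨(Pi.single i (1 : ℝ), R), by simp, ?_⟩
        simp [Pi.single_apply]
        linarith

end HalfSpaces

/-! ### Upper bound in `τ_Θ` -/

section Upper

variable {Υ : Type*} [MeasurableSpace Υ] {μ : Measure Υ} {P : Measure S} [IsProbabilityMeasure P]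
  {X : ℕ → Υ → S}

/-- On a half-space `(l, r)` the Chernoff tilt `η = 2 * c / r` costs `η ^ 2 * Var / 2 ≤ c` and gains
`η * r = 2 * c`, leaving `-c`. A union bound over the finite cover finishes. -/
theorem eventually_prob_deviation_le_exp {ι : Type*} [Fintype ι]
    {a : ℕ → ℝ} (hapos : ∀ n, 1 ≤ n → 0 < a n) {k : ℕ → ℕ} (hk_top : Tendsto k atTop atTop)
    (hka : Tendsto (fun n => (k n : ℝ) * a n ^ 2) atTop atTop)
    {f : ι → S → ℝ} (hf : ∀ i, IsAdmissible μ X P a (f i)) {b c : ℝ} (hc : 0 ≤ c) (hbc : b < c)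
    {ε₀ : ℝ} (hε₀ : 0 < ε₀) :
    ∃ F : Finset (S → ℝ), (∀ φ ∈ F, IsAdmissible μ X P a φ) ∧
      ∃ ε > 0, ∀ᶠ n in atTop, ∀ x : Fin n → S,
        (∀ φ ∈ F, |logMgf x (a n) φ - Var[φ; P] / 2| < ε) →
        (Measure.pi fun _ : Fin (k n) => empirical x).real
          {y | ∀ g, IsDensity P c g →
            ∃ i, ε₀ ≤ |deviation x (a n) (f i) y - ∫ s, f i s * g s ∂P|} ≤
          Real.exp (-(k n * a n ^ 2 * b)) := by
  classical
  obtain ⟨T, hT, hcover⟩ := exists_finset_halfSpaces (P := P) (fun i => (hf i).measurable)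
    (fun i => (hf i).memLp) hc hε₀
  have hφ : ∀ l : ι → ℝ, IsAdmissible μ X P a (fun s => ∑ i, l i * f i s) := fun l =>
    IsAdmissible.sum_mul hapos _ l fun i _ => hf i
  -- One `ε` covers the error in `logMgf`, the other absorbs the number of half-spaces.
  set ε := (c - b) / 2 with hε
  have hε0 : 0 < ε := by rw [hε]; linarith
  refine ⟨T.image fun p s => 2 * c / p.2 * ∑ i, p.1 i * f i s, ?_, ε, hε0, ?_⟩
  · intro φ hφ'
    obtain ⟨p, -, rfl⟩ := Finset.mem_image.1 hφ'
    exact (hφ p.1).const_mul _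
  have hlim : Tendsto (fun n => Real.exp (-(ε * (k n * a n ^ 2)))) atTop (𝓝 0) :=
    Real.tendsto_exp_neg_atTop_nhds_zero.comp (hka.const_mul_atTop hε0)
  filter_upwards [eventually_ge_atTop 1, hk_top.eventually_ge_atTop 1,
    hlim.eventually (gt_mem_nhds (show (0 : ℝ) < 1 / (T.card + 1) by positivity))]
    with n hn hk hlt x hx
  have := isProbabilityMeasure_empirical (by lia) x
  set t : ℝ := k n * a n ^ 2 with ht
  have ht0 : 0 ≤ t := by positivity
  have hterm : ∀ p ∈ T, (Measure.pi fun _ : Fin (k n) => empirical x).real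
      {y | p.2 ≤ deviation x (a n) (fun s => ∑ i, p.1 i * f i s) y} ≤
      Real.exp (-(t * b)) * Real.exp (-(ε * t)) := by
    intro p hp
    obtain ⟨hp0, hpV⟩ := hT p hp
    have hη : 0 ≤ 2 * c / p.2 := by positivity
    refine (prob_le_exp_logMgf (by lia) (by lia) x (hapos n hn) (hφ p.1).measurable p.2 hη).trans ?_
    have h1 := (abs_lt.1 (hx _ (Finset.mem_image_of_mem _ hp))).2
    rw [variance_const_mul] at h1
    rw [← Real.exp_add]
    have h2 : 2 * c / p.2 * p.2 = 2 * c := by field_simp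
    have h3 : (2 * c / p.2) ^ 2 * Var[fun s => ∑ i, p.1 i * f i s; P] ≤ 2 * c := by
      rw [div_pow, div_mul_eq_mul_div, div_le_iff₀ (by positivity)]
      nlinarith
    have h4 : (logMgf x (a n) fun s => 2 * c / p.2 * ∑ i, p.1 i * f i s) - 2 * c / p.2 * p.2 ≤
        -b - ε := by
      rw [h2]
      have : c - b = 2 * ε := by rw [hε]; ring
      linarith
    calc Real.exp (t * _) ≤ Real.exp (t * (-b - ε)) := by gcongr
      _ = _ := by congr 1; ring
  have hsub : {y : Fin (k n) → S | ∀ g, IsDensity P c g →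
      ∃ i, ε₀ ≤ |deviation x (a n) (f i) y - ∫ s, f i s * g s ∂P|} ⊆
      ⋃ p ∈ T, {y | p.2 ≤ deviation x (a n) (fun s => ∑ i, p.1 i * f i s) y} := by
    intro y hy
    obtain ⟨p, hp, hle⟩ := hcover (fun i => deviation x (a n) (f i) y) hy
    refine Set.mem_iUnion₂.2 ⟨p, hp, ?_⟩
    rw [Set.mem_ofPred_eq, deviation_sum_mul]
    exact hle
  refine (measureReal_mono hsub (measure_ne_top _ _)).trans ((measureReal_biUnion_finset_le _ _).trans
    ((Finset.sum_le_sum hterm).trans ?_))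
  rw [Finset.sum_const, nsmul_eq_mul]
  rw [lt_div_iff₀ (by positivity)] at hlt
  have h1 : (T.card : ℝ) * Real.exp (-(ε * t)) ≤ 1 := by
    nlinarith [Real.exp_pos (-(ε * t))]
  calc (T.card : ℝ) * (Real.exp (-(t * b)) * Real.exp (-(ε * t))) =
      Real.exp (-(t * b)) * (T.card * Real.exp (-(ε * t))) := by ring
    _ ≤ Real.exp (-(t * b)) * 1 := by gcongr
    _ = _ := mul_one _

theorem limsupLe_bootstrapOuter (hX : ∀ i, Measurable (X i)) (hindep : iIndepFun X μ)
    (hlaw : ∀ i, μ.map (X i) = P) {a : ℕ → ℝ} (ha : Tendsto a atTop (𝓝 0))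
    (hapos : ∀ n, 1 ≤ n → 0 < a n) {k : ℕ → ℕ} (hk_top : Tendsto k atTop atTop)
    (hka : Tendsto (fun n => (k n : ℝ) * a n ^ 2) atTop atTop)
    {Θ : Set (S → ℝ)} (hΘ : ∀ f ∈ Θ, IsAdmissible μ X P a f) (Ω₀ : Set (ZeroMassMeasure Θ)) :
    LimsupLeOuterAS μ
      (fun n ω => (((k n * a n ^ 2)⁻¹ : ℝ) : EReal) *
        ENNReal.log (bootstrapOuter (sample X n ω) (k n) (a n) Ω₀))
      (-(rateSet P (closure Ω₀) : EReal)) := by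
  have hΘm : ∀ f ∈ Θ, Measurable f := fun f hf => (hΘ f hf).measurable
  have hΘL : ∀ f ∈ Θ, MemLp f 2 P := fun f hf => (hΘ f hf).memLp
  refine liminfGeInnerAS_of_logMgf hX hindep hlaw ha hapos fun r hr => ?_
  rw [neg_neg] at hr
  suffices h : ∃ F : Finset (S → ℝ), (∀ φ ∈ F, IsAdmissible μ X P a φ) ∧
      ∃ ε > 0, ∀ᶠ n in atTop, ∀ ω,
        (∀ φ ∈ F, |logMgf (sample X n ω) (a n) φ - Var[φ; P] / 2| < ε) →
          bootstrapOuter (sample X n ω) (k n) (a n) Ω₀ ≤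
            ENNReal.ofReal (Real.exp (k n * a n ^ 2 * -r)) by
    obtain ⟨F, hF, ε, hε, hev⟩ := h
    refine ⟨F, hF, ε, hε, ?_⟩
    filter_upwards [hev, hka.eventually_gt_atTop 0] with n hn ht ω hω
    rw [EReal.le_neg, ← EReal.coe_neg]
    exact inv_mul_log_le ht (hn ω hω)
  -- For negative `r` the target is at least `1`.
  rcases lt_or_ge r 0 with hr0 | hr0
  · refine ⟨∅, by simp, 1, one_pos, ?_⟩
    filter_upwards [eventually_ge_atTop 1, hk_top.eventually_ge_atTop 1,
      hka.eventually_gt_atTop 0] with n hn hk ht ω _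
    have := isProbabilityMeasure_empirical (by lia) (sample X n ω)
    have hn0 : n ≠ 0 := by lia
    have hk0 : k n ≠ 0 := by lia
    calc bootstrapOuter (sample X n ω) (k n) (a n) Ω₀ ≤ 1 :=
          (bootstrapOuter_le_prob hΘm hn0 hk0 _ (hapos n hn).ne' MeasurableSet.univ
            (Set.subset_univ _)).trans prob_le_one
      _ ≤ _ := by
          rw [← ENNReal.ofReal_one]
          refine ENNReal.ofReal_le_ofReal (Real.one_le_exp ?_)
          nlinarith
  obtain ⟨c, hrc, hc⟩ : ∃ c : ℝ, r < c ∧ ENNReal.ofReal c < rateSet P (closure Ω₀) := by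
    obtain ⟨q, hrq, hq⟩ := EReal.exists_rat_btwn_of_lt hr
    have hrq' : r < q := by exact_mod_cast hrq
    refine ⟨q, hrq', ?_⟩
    rw [← EReal.coe_ennreal_lt_coe_ennreal_iff, EReal.coe_ennreal_ofReal,
      max_eq_left (hr0.trans hrq'.le)]
    exact hq
  have hc0 : 0 ≤ c := hr0.trans hrc.le
  -- A common point would be a measure in the closure of `Ω₀` with rate at most `c`, below the
  -- infimum.
  have hdisj : Disjoint
      {v : Θ → ℝ | ∃ g, IsDensity P c g ∧ ∀ f : Θ, v f = ∫ s, (f : S → ℝ) s * g s ∂P}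
      (closure (evalMap Θ '' Ω₀)) := by
    rw [Set.disjoint_left]
    rintro v ⟨g, hg, hv⟩ hcl
    obtain ⟨G, hGe, hGr⟩ := exists_zeroMassMeasure_of_density hΘm hΘL hg.measurable hg.memLp
      hg.integral_eq_zero
    have hvG : v = evalMap Θ G := by
      funext f
      rw [hv, hGe]
    rw [hvG] at hcl
    have hG : G ∈ closure Ω₀ := closure_induced.2 hcl
    have h1 : rateSet P (closure Ω₀) ≤ rate P G.val := iInf₂_le G hG
    rw [hGr] at h1
    refine absurd (hc.trans_le h1) (not_lt.2 (ENNReal.ofReal_le_ofReal ?_))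
    have := hg.integral_sq_le
    linarith
  obtain ⟨V, hV, hVd⟩ := hdisj.exists_uniform_thickening
    (isCompact_setOf_pairing (fun f : Θ => hΘL f f.2) hc0) isClosed_closure
  obtain ⟨I, ε₀, hε₀, hI⟩ := exists_finset_of_mem_uniformity_pi hV
  obtain ⟨F, hF, ε, hε, hev⟩ := eventually_prob_deviation_le_exp hapos hk_top hka
    (f := fun i : I => ((i : Θ) : S → ℝ)) (fun i => hΘ _ i.1.2) hc0 hrc hε₀
  refine ⟨F, hF, ε, hε, ?_⟩
  filter_upwards [hev, eventually_ge_atTop 1, hk_top.eventually_ge_atTop 1] with n hn hn1 hk1 ω hω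
  have hn0 : n ≠ 0 := by lia
  have hk0 : k n ≠ 0 := by lia
  have hp := hn _ hω
  set B : Set (I → ℝ) := {w | ∀ g, IsDensity P c g →
    ∃ i, ε₀ ≤ |w i - ∫ s, ((i : Θ) : S → ℝ) s * g s ∂P|} with hB
  have hBc : IsClosed B := by
    have : B = ⋂ g, ⋂ (_ : IsDensity P c g), ⋃ i : I,
        {w | ε₀ ≤ |w i - ∫ s, ((i : Θ) : S → ℝ) s * g s ∂P|} := by
      ext; simp [hB]
    rw [this]
    refine isClosed_iInter fun g => isClosed_iInter fun _ => isClosed_iUnion_of_finite fun i => ?_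
    exact isClosed_le continuous_const (by fun_prop)
  -- This is the `σ_Θ`-measurable cover of `Ω₀`: it depends on finitely many coordinates, and `B` is
  -- closed although it is an intersection over all densities.
  set A : Set (ZeroMassMeasure Θ) := {G | (fun i : I => evalMap Θ G i) ∈ B} with hA
  have hAm : MeasurableSet A :=
    ⟨(fun (v : Θ → ℝ) (i : I) => v i) ⁻¹' B,
      (measurable_pi_lambda _ fun i => measurable_pi_apply _) hBc.measurableSet, rfl⟩
  have hΩA : Ω₀ ⊆ A := by
    intro G hG g hg
    by_contra! hlt
    refine (Set.disjoint_left.1 hVd : ∀ ⦃v⦄, _ → _) (?_ : evalMap Θ G ∈ _) ?_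
    · refine Set.mem_iUnion₂.2 ⟨fun f => ∫ s, (f : S → ℝ) s * g s ∂P, ⟨g, hg, fun f => rfl⟩, ?_⟩
      exact hI _ _ fun i hi => hlt ⟨i, hi⟩
    · refine Set.mem_iUnion₂.2 ⟨evalMap Θ G, subset_closure ⟨G, hG, rfl⟩, ?_⟩
      exact refl_mem_uniformity hV
  refine (bootstrapOuter_le_prob hΘm hn0 hk0 _ (hapos n hn1).ne' hAm hΩA).trans ?_
  have := isProbabilityMeasure_empirical hn0 (sample X n ω)
  rw [← ofReal_measureReal]
  refine ENNReal.ofReal_le_ofReal ?_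
  rw [mul_neg]
  convert hp using 2
  ext y
  simp only [hA, hB, Set.mem_ofPred_eq, evalMap_deviationMeasure]

theorem conditionalMDP_of_isAdmissible (hX : ∀ i, Measurable (X i)) (hindep : iIndepFun X μ)
    (hlaw : ∀ i, μ.map (X i) = P) {a : ℕ → ℝ} (ha : Tendsto a atTop (𝓝 0))
    (hapos : ∀ n, 1 ≤ n → 0 < a n) {k : ℕ → ℕ} (hk_top : Tendsto k atTop atTop)
    (hka : Tendsto (fun n => (k n : ℝ) * a n ^ 2) atTop atTop)
    {Θ : Set (S → ℝ)} (hΘ : ∀ f ∈ Θ, IsAdmissible μ X P a f) :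
    ConditionalMDP μ X P k a Θ := fun Ω₀ =>
  ⟨liminfGe_bootstrapInner hX hindep hlaw ha hapos hk_top hka hΘ Ω₀,
    limsupLe_bootstrapOuter hX hindep hlaw ha hapos hk_top hka hΘ Ω₀⟩

end Upper

/-! ### Admissibility of the function classes -/

/-- For `i < n` monotonicity gives `a n * z i ≤ a (i + 1) * z i`, which handles late indices; the
finitely many early ones vanish with `a n`. The shift is there because `z i` stands for observation
number `i + 1`. -/
theorem eventually_forall_lt_mul_le {a z : ℕ → ℝ} (hapos : ∀ n, 1 ≤ n → 0 < a n)
    (ha_anti : AntitoneOn a (Set.Ici 1)) (ha : Tendsto a atTop (𝓝 0)) (hz : ∀ i, 0 ≤ z i)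
    {ε : ℝ} (hε : 0 < ε) (h : ∀ᶠ i in atTop, a (i + 1) * z i ≤ ε) :
    ∀ᶠ n in atTop, ∀ i < n, a n * z i ≤ ε := by
  obtain ⟨N, hN⟩ := eventually_atTop.1 h
  have hlim : Tendsto (fun n => a n * ∑ i ∈ Finset.range N, z i) atTop (𝓝 0) := by
    simpa using ha.mul_const (∑ i ∈ Finset.range N, z i)
  filter_upwards [hlim.eventually (gt_mem_nhds hε), eventually_ge_atTop 1] with n hn hn1 i hi
  have hpos := hapos n hn1
  rcases lt_or_ge i N with hiN | hiN
  · have := Finset.single_le_sum (fun j _ => hz j) (Finset.mem_range.2 hiN)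
    exact (mul_le_mul_of_nonneg_left this hpos.le).trans hn.le
  · refine le_trans ?_ (hN i hiN)
    exact mul_le_mul_of_nonneg_right (ha_anti (by simp) (by simpa using hn1) (by lia)) (hz i)

section Classes

variable {Υ : Type*} [MeasurableSpace Υ] {μ : Measure Υ} {P : Measure S}
  {X : ℕ → Υ → S} {a : ℕ → ℝ}

theorem ae_eventually_mul_le_of_tsum (hX : ∀ i, Measurable (X i)) (hlaw : ∀ i, μ.map (X i) = P)
    {f : S → ℝ} (hf : Measurable f)
    (h : ∀ ε : ℝ, 0 < ε → ∑' n, P {s | ε < a (n + 1) * |f s|} ≠ ∞) :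
    ∀ᵐ ω ∂μ, ∀ ε > 0, ∀ᶠ n in atTop, a (n + 1) * |f (X n ω)| ≤ ε := by
  have key : ∀ m : ℕ, ∀ᵐ ω ∂μ, ∀ᶠ n in atTop, a (n + 1) * |f (X n ω)| ≤ 1 / ((m : ℝ) + 1) := by
    intro m
    have hs : ∀ n, μ (X n ⁻¹' {s | 1 / ((m : ℝ) + 1) < a (n + 1) * |f s|}) =
        P {s | 1 / ((m : ℝ) + 1) < a (n + 1) * |f s|} := fun n => by
      rw [← hlaw n, Measure.map_apply (hX n) (measurableSet_lt measurable_const (by fun_prop))]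
    have := ae_eventually_notMem (μ := μ)
      (s := fun n => X n ⁻¹' {s | 1 / ((m : ℝ) + 1) < a (n + 1) * |f s|})
      (by simp_rw [hs]; exact h _ Nat.one_div_pos_of_nat)
    filter_upwards [this] with ω hω
    filter_upwards [hω] with n hn
    simpa using hn
  filter_upwards [ae_all_iff.2 key] with ω hω ε hε
  obtain ⟨m, hm⟩ := exists_nat_one_div_lt hε
  filter_upwards [hω m] with n hn
  exact hn.trans hm.le

theorem isAdmissible_of_mem_boundedClass [IsProbabilityMeasure P]
    (hapos : ∀ n, 1 ≤ n → 0 < a n) (ha : Tendsto a atTop (𝓝 0)) {f : S → ℝ}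
    (hf : f ∈ boundedClass S) : IsAdmissible μ X P a f := by
  obtain ⟨hfm, C, hC⟩ := hf
  refine ⟨hfm, MemLp.of_bound hfm.aestronglyMeasurable C (ae_of_all _ hC),
    ae_of_all _ fun ω ε hε => ?_⟩
  have hlim : Tendsto (fun n => a n * C) atTop (𝓝 0) := by simpa using ha.mul_const C
  filter_upwards [hlim.eventually (gt_mem_nhds hε), eventually_ge_atTop 1] with n hn hn1 i _
  exact (mul_le_mul_of_nonneg_left (hC _) (hapos n hn1).le).trans hn.le

theorem memLp_of_mem_momentClass {t : ℝ} (ht : 0 < t) {f : S → ℝ} (hf : f ∈ momentClass P t) :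
    MemLp f (ENNReal.ofReal t) P := by
  rw [← integrable_norm_rpow_iff hf.1.aestronglyMeasurable (by simpa using ht) (by simp),
    ENNReal.toReal_ofReal ht.le]
  exact hf.2

theorem isAdmissible_of_mem_tailClass [IsProbabilityMeasure P] (hX : ∀ i, Measurable (X i))
    (hlaw : ∀ i, μ.map (X i) = P) (hapos : ∀ n, 1 ≤ n → 0 < a n)
    (ha_anti : AntitoneOn a (Set.Ici 1)) (ha : Tendsto a atTop (𝓝 0)) {h : ℝ → ℝ}
    (hsum : ∀ c : ℝ, 0 < c → Summable (fun n : ℕ => h (c * a (n + 1)))) {f : S → ℝ}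
    (hf : f ∈ tailClass P 2 h) : IsAdmissible μ X P a f := by
  obtain ⟨hfm, hft⟩ := hf
  refine ⟨hfm.1, by simpa using memLp_of_mem_momentClass two_pos hfm, ?_⟩
  have := ae_eventually_mul_le_of_tsum (a := a) hX hlaw hfm.1 fun ε hε => by
    -- The event `ε < a (n + 1) * |f|` is the tail event of the class at `s = ε⁻¹ * a (n + 1)`.
    refine ne_top_of_le_ne_top ((hsum ε⁻¹ (by positivity)).tsum_ofReal_ne_top)
      (ENNReal.tsum_le_tsum fun n => ?_)
    have hpos := hapos (n + 1) (by lia)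
    have hlt := hft (ε⁻¹ * a (n + 1)) (by positivity)
    rw [← ofReal_measureReal]
    refine ENNReal.ofReal_le_ofReal (le_trans (le_of_eq ?_) hlt.le)
    congr 1
    ext s
    simp only [Set.mem_ofPred_eq]
    rw [mul_inv, inv_inv, ← div_eq_mul_inv, div_lt_iff₀ hpos, mul_comm]
  filter_upwards [this] with ω hω ε hε
  exact eventually_forall_lt_mul_le hapos ha_anti ha (fun i => abs_nonneg _) hε (hω ε hε)

/-- Borel-Cantelli is applied with weights `n ^ (-1 / t)` in place of `a`: the finite `t`-th moment
makes `∑ P(|f| ^ t > ε ^ t * n)` converge. The little-o assumption then transfers the bound to `a`,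
so the maxima are needed only at level `1`. -/
theorem isAdmissible_of_mem_momentClass [IsProbabilityMeasure P] (hX : ∀ i, Measurable (X i))
    (hlaw : ∀ i, μ.map (X i) = P) (hapos : ∀ n, 1 ≤ n → 0 < a n) {t : ℝ} (ht : 2 < t)
    (hat : a =o[atTop] (fun n : ℕ => (n : ℝ) ^ (-(1 / t)))) {f : S → ℝ}
    (hf : f ∈ momentClass P t) : IsAdmissible μ X P a f := by
  have ht0 : 0 < t := by linarith
  have hpos : ∀ n : ℕ, 1 ≤ n → 0 < (n : ℝ) ^ (-(1 / t)) := fun n hn =>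
    Real.rpow_pos_of_pos (by exact_mod_cast hn) _
  have hanti : AntitoneOn (fun n : ℕ => (n : ℝ) ^ (-(1 / t))) (Set.Ici 1) := by
    intro m hm n _ hmn
    refine Real.rpow_le_rpow_of_nonpos ?_ (by exact_mod_cast hmn) ?_
    · exact_mod_cast (Set.mem_Ici.1 hm)
    · have : 0 < 1 / t := by positivity
      linarith
  have hlim : Tendsto (fun n : ℕ => (n : ℝ) ^ (-(1 / t))) atTop (𝓝 0) :=
    (tendsto_rpow_neg_atTop (by positivity)).comp tendsto_natCast_atTop_atTop
  refine ⟨hf.1, (memLp_of_mem_momentClass ht0 hf).mono_exponent ?_, ?_⟩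
  · rw [← ENNReal.ofReal_ofNat 2]
    exact ENNReal.ofReal_le_ofReal ht.le
  have hfm := hf.1
  have := ae_eventually_mul_le_of_tsum (a := fun n : ℕ => (n : ℝ) ^ (-(1 / t))) hX hlaw hfm
    fun ε hε => by
      let _ : MeasureSpace S := ⟨P⟩
      have hlt := tsum_prob_mem_Ioi_lt_top (Ω := S) (X := fun s => (ε ^ t)⁻¹ * |f s| ^ t)
        (hf.2.const_mul _) (fun s => by positivity)
      refine ne_top_of_le_ne_top hlt.ne (ENNReal.tsum_le_tsum fun n => measure_mono fun s hs => ?_)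
      simp only [Set.mem_ofPred_eq, Set.mem_Ioi] at hs ⊢
      have hn : (0 : ℝ) < ((n + 1 : ℕ) : ℝ) := by positivity
      have h1 : ε ^ t < (((n + 1 : ℕ) : ℝ) ^ (-(1 / t)) * |f s|) ^ t :=
        Real.rpow_lt_rpow hε.le hs ht0
      rw [Real.mul_rpow (by positivity) (abs_nonneg _), ← Real.rpow_mul hn.le, neg_mul,
        one_div_mul_cancel ht0.ne', Real.rpow_neg_one, lt_inv_mul_iff₀ hn] at h1
      rw [lt_inv_mul_iff₀ (by positivity)]
      refine lt_of_le_of_lt ?_ h1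
      rw [mul_comm]
      push_cast
      gcongr
      linarith
  filter_upwards [this] with ω hω ε hε
  filter_upwards [eventually_forall_lt_mul_le hpos hanti hlim (fun i => abs_nonneg _) one_pos
    (hω 1 one_pos), hat.bound hε, eventually_ge_atTop 1] with n h1 h2 hn i hi
  rw [Real.norm_of_nonneg (hapos n hn).le, Real.norm_of_nonneg (hpos n hn).le] at h2
  calc a n * |f (X i ω)| ≤ ε * (n : ℝ) ^ (-(1 / t)) * |f (X i ω)| := by gcongr
    _ = ε * ((n : ℝ) ^ (-(1 / t)) * |f (X i ω)|) := by ring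
    _ ≤ ε * 1 := by gcongr; exact h1 i hi
    _ = ε := mul_one _

end Classes

end BootstrapMDP

end


theorem mainTheorem1 {S : Type*} [TopologicalSpace S] [T2Space S] [MeasurableSpace S]
    [BorelSpace S] (P : Measure S) [IsProbabilityMeasure P]
    {Υ : Type*} [MeasurableSpace Υ] (μ : Measure Υ) [IsProbabilityMeasure μ]
    (X : ℕ → Υ → S) (hX : ∀ i, Measurable (X i)) (hindep : iIndepFun X μ)
    (hlaw : ∀ i, μ.map (X i) = P)
    (k : ℕ → ℕ) (hk : ∃ c : ℝ, ∀ n, 1 ≤ n → (k n : ℝ) / n < c) (hk_top : Tendsto k atTop atTop)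
    (a : ℕ → ℝ) (ha_pos : ∀ n, 1 ≤ n → 0 < a n) (ha_anti : AntitoneOn a (Set.Ici 1))
    (ha_zero : Tendsto a atTop (𝓝 0))
    (ha_ratio : Tendsto (fun n => a (n + 1) / a n) atTop (𝓝 1))
    (hka : Tendsto (fun n => (k n : ℝ) * a n ^ 2) atTop atTop) :
    (∀ h : ℝ → ℝ, (∀ s, 0 < s → 0 ≤ h s) →
      (∀ c : ℝ, 0 < c → Summable (fun n : ℕ => h (c * a (n + 1)))) →
        BootstrapMDP.ConditionalMDP μ X P k a (BootstrapMDP.tailClass P 2 h) ∧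
        BootstrapMDP.ConditionalMDP μ X P k a (BootstrapMDP.tailClass P 2 h ∪ BootstrapMDP.boundedClass S)) ∧
    (∀ t : ℝ, 2 < t → a =o[atTop] (fun n : ℕ => (n : ℝ) ^ (-(1 / t))) →
      BootstrapMDP.ConditionalMDP μ X P k a (BootstrapMDP.momentClass P t)) := by

  refine ⟨fun h _ hsum => ?_, fun t ht hat => ?_⟩
  · have htail : ∀ f ∈ BootstrapMDP.tailClass P 2 h, BootstrapMDP.IsAdmissible μ X P a f :=
      fun f hf => BootstrapMDP.isAdmissible_of_mem_tailClass hX hlaw ha_pos ha_anti ha_zero hsum hf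
    refine ⟨BootstrapMDP.conditionalMDP_of_isAdmissible hX hindep hlaw ha_zero ha_pos hk_top hka
      htail, BootstrapMDP.conditionalMDP_of_isAdmissible hX hindep hlaw ha_zero ha_pos hk_top hka ?_⟩
    rintro f (hf | hf)
    · exact htail f hf
    · exact BootstrapMDP.isAdmissible_of_mem_boundedClass ha_pos ha_zero hf
  · exact BootstrapMDP.conditionalMDP_of_isAdmissible hX hindep hlaw ha_zero ha_pos hk_top hka
      fun f hf => BootstrapMDP.isAdmissible_of_mem_momentClass hX hlaw ha_pos ht hat hf
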